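/- Let $\Omega\subset\mathbb{R}^N$ ($N\ge 1$) be a bounded domain (nonempty, open, connected), $A,b_0>0$, $\sigma\in(0,2)$, $m>\max\{1,\sigma\}$, $\theta\in[0,m)$, and put $$\gamma_0=\min\Big\{\frac{m-\sigma}{m},\frac{m-\theta}{m}\Big\}.$$ Let $B_\delta$ be the open ball of radius $\delta$ centred at $0$, $B=B_1$, and for $\delta>0$ let $h_{\alpha,\sigma}(\delta)=\delta^{\alpha-\sigma}$ if $\alpha<\sigma$, $h_{\alpha,\sigma}(\delta)=|\ln\delta|+1$ if $\alpha=\sigma$, $h_{\alpha,\sigma}(\delta)=1$ if $\alpha>\sigma$. Let $\nu$ be a positive Borel measure on $\mathbb{R}^N$ such that (M1) for every $\alpha\in[0,2]$ there is $K_1(\alpha)$ with $\int_{B_\delta^c}\min\{1,|z|^\alpha\}\,\nu(dz)\le K_1(\alpha)\,h_{\alpha,\sigma}(\delta)$ for all $\delta>0$ (with $|z|^0=1$); (M2) for every $\alpha\in(\sigma,2]$ there is $K_2(\alpha)$ with $\int_{B_\delta}|z|^\alpha\,\nu(dz)\le K_2(\alpha)\,\delta^{\alpha-\sigma}$ for all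 $\delta\in(0,1)$. Let $j:\mathbb{R}^N\times\mathbb{R}^N\to\mathbb{R}^N$ (Borel in $z$) satisfy (J1): $|j(x,z)|\le C_j|z|$ for all $x,z$, with $C_j>0$. For $\sigma\ge 1$ let $$I_x^j(u,x)=\int_{\mathbb{R}^N}\big[u(x+j(x,z))-u(x)-\mathbf 1_B(z)\langle Du(x),j(x,z)\rangle\big]\,\nu(dz),$$ and for $\sigma<1$ let $I_x^j(u,x)=\int_{\mathbb{R}^N}[u(x+j(x,z))-u(x)]\,\nu(dz)$. Let $\nu_x^j$ be the push-forward of $\nu$ under $j(x,\cdot)$ and $\Omega_{\nu^j}=\Omega\cup\bigcup_{x\in\bar\Omega}\big(x+\mathrm{supp}\,\nu_x^j\big)$. Write $d_\Omega(x)$ for the distance of $x\in\Omega$ to $\partial\Omega$ and $\mathrm{osc}_S(u)=\sup_S u-\inf_S u$. Let $u:\mathbb{R}^N\to\mathbb{R}$ be a bounded (Borel) viscosity subsolution of $$-I_x^j(u,x)+b_0|Du(x)|^m\le A\,d_\Omega(x)^{-\theta},\qquad x\in\Omega,$$ that is: $u$ is upper semicontinuous in $\Omega$, and whenever $x\in\Omega$,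 $\varphi\in C^2(\mathbb{R}^N)$, $\rho>0$, $u-\varphi$ has a maximum over $B_\rho(x)$ at $x$, and $\delta>0$ satisfies $x+j(x,z)\in B_\rho(x)$ for all $z\in B_\delta$, the inequality holds at $x$ with $D\varphi(x)$ in place of $Du(x)$ and with $u$ replaced by $\varphi$ in the part of the integral over $z\in B_\delta$. Then $u$ is locally Hölder continuous in $\Omega$ with exponent $\gamma_0$: there is a constant $L$, depending only on $N,\Omega,A,b_0,\sigma,m,\theta$, the constants in (M1), (M2), (J1), and (monotonically) on $\mathrm{osc}_{\Omega_{\nu^j}}(u)$, such that for every $x_0\in\Omega$ and $0<r\le d_\Omega(x_0)/4$ $$|u(x)-u(y)|\le L|x-y|^{\gamma_0}\qquad\text{for all }x,y\in B_r(x_0).$$ Moreover, if $\Omega$ has a $C^{1,1}$ boundary, then $u|_\Omega$ extends to a function $v$ on $\bar\Omega$ with $|v(x)-v(y)|\le L|x-y|^{\gamma_0}$ for all $x,y\in\bar\Omega$. -/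

import Mathlib

open MeasureTheory Set

noncomputable section

/-- The space `ℝ^N` with its Euclidean norm. -/
abbrev RN (N : ℕ) : Type := EuclideanSpace ℝ (Fin N)

/-- The distance to the boundary of `Ω` (evaluated only at points of `Ω`). -/
def bdryDist {N : ℕ} (Ω : Set (RN N)) (x : RN N) : ℝ :=
  Metric.infDist x (frontier Ω)

/-- The oscillation `sup_S u - inf_S u`. -/
def osc {N : ℕ} (S : Set (RN N)) (u : RN N → ℝ) : ℝ :=
  sSup (u '' S) - sInf (u '' S)

/-- The function `h_{α,σ}(δ)`, `δ > 0`. -/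
def hFun (α σ δ : ℝ) : ℝ :=
  if α < σ then δ ^ (α - σ) else if α = σ then |Real.log δ| + 1 else 1

/-- Condition (M1) for a single measure `ν`, with constants `K α`. -/
def CondM1 {N : ℕ} (σ : ℝ) (K : ℝ → ℝ) (ν : Measure (RN N)) : Prop :=
  ∀ α ∈ Icc (0 : ℝ) 2, ∀ δ : ℝ, 0 < δ →
    ∫⁻ z in (Metric.ball (0 : RN N) δ)ᶜ, ENNReal.ofReal (min 1 (‖z‖ ^ α)) ∂ν
      ≤ ENNReal.ofReal (K α * hFun α σ δ)

/-- Condition (M2) for a single measure `ν`, with constants `K α`. -/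
def CondM2 {N : ℕ} (σ : ℝ) (K : ℝ → ℝ) (ν : Measure (RN N)) : Prop :=
  ∀ α ∈ Ioc σ 2, ∀ δ ∈ Ioo (0 : ℝ) 1,
    ∫⁻ z in Metric.ball (0 : RN N) δ, ENNReal.ofReal (‖z‖ ^ α) ∂ν
      ≤ ENNReal.ofReal (K α * δ ^ (α - σ))

/-- Condition (J1) with constant `Cj`, for a jump function that is Borel in the variable `z`. -/
def CondJ1 {N : ℕ} (Cj : ℝ) (j : RN N → RN N → RN N) : Prop :=
  (∀ x, Measurable (j x)) ∧ ∀ x z, ‖j x z‖ ≤ Cj * ‖z‖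

/-- The measure `ν_x^j`, the push-forward of `ν` through `j(x, ·)`. -/
def pushMeasure {N : ℕ} (ν : Measure (RN N)) (j : RN N → RN N → RN N) (x : RN N) :
    Measure (RN N) :=
  ν.map (j x)

/-- The set `Ω_{ν^j} = Ω ∪ ⋃_{x ∈ closure Ω} (x + supp ν_x^j)`. -/
def reachableSet {N : ℕ} (Ω : Set (RN N)) (ν : Measure (RN N)) (j : RN N → RN N → RN N) :
    Set (RN N) :=
  Ω ∪ ⋃ x ∈ closure Ω, (fun z => x + z) '' (pushMeasure ν j x).support

/-- The part over `z ∈ S` of the Lévy–Itô operator at `x`, with the vector `p` as gradient: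
`∫_S [φ(x + j(x,z)) - φ(x) - 1_B(z) ⟨p, j(x,z)⟩] ν(dz)`, where the compensator is present
only for `σ ≥ 1`. -/
def levyIto {N : ℕ} (σ : ℝ) (ν : Measure (RN N)) (j : RN N → RN N → RN N)
    (S : Set (RN N)) (φ : RN N → ℝ) (x p : RN N) : ℝ :=
  ∫ z in S, (φ (x + j x z) - φ x -
    (if 1 ≤ σ ∧ ‖z‖ < 1 then inner ℝ p (j x z) else 0)) ∂ν

/-- `u` is a viscosity subsolution of
`-I_x^j(u,x) + b₀ |Du(x)|^m ≤ A d_Ω(x)^{-θ}` in `Ω`: it is upper semicontinuous in `Ω`, and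
whenever `φ` is `C²` and `u - φ` has a maximum over a ball `B_ρ(x)` at its centre `x ∈ Ω`, the
inequality holds with `φ` in place of `u` for the small jumps `z ∈ B_δ`
(those with `x + j(x,z) ∈ B_ρ(x)`) and in the gradient. -/
def IsViscositySubsolution {N : ℕ} (σ m θ A b₀ : ℝ) (ν : Measure (RN N))
    (j : RN N → RN N → RN N) (Ω : Set (RN N)) (u : RN N → ℝ) : Prop :=
  UpperSemicontinuousOn u Ω ∧
  ∀ x ∈ Ω, ∀ φ : RN N → ℝ, ContDiff ℝ 2 φ →
    ∀ ρ : ℝ, 0 < ρ → (∀ y ∈ Metric.ball x ρ, u y - φ y ≤ u x - φ x) →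
    ∀ δ : ℝ, 0 < δ → (∀ z ∈ Metric.ball (0 : RN N) δ, x + j x z ∈ Metric.ball x ρ) →
      -(levyIto σ ν j (Metric.ball 0 δ) φ x (gradient φ x))
        - levyIto σ ν j (Metric.ball 0 δ)ᶜ u x (gradient φ x)
        + b₀ * ‖gradient φ x‖ ^ m ≤ A * bdryDist Ω x ^ (-θ)

/-- `Ω` has a `C^{1,1}` boundary: near each boundary point, after choosing a unit vector `e` as
vertical direction, `Ω` is the region above the graph of a `C^{1,1}` function of the horizontal
component `y - ⟨e,y⟩ e`. -/
def HasC11Boundary {N : ℕ} (Ω : Set (RN N)) : Prop :=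
  ∀ x ∈ frontier Ω, ∃ e : RN N, ‖e‖ = 1 ∧ ∃ ψ : RN N → ℝ, ContDiff ℝ 1 ψ ∧
    (∃ K : NNReal, LipschitzWith K (fderiv ℝ ψ)) ∧
    ∃ r : ℝ, 0 < r ∧ ∀ y ∈ Metric.ball x r,
      (y ∈ Ω ↔ ψ (y - (inner ℝ e y : ℝ) • e) < inner ℝ e y)

/-- The exponent `γ₀ = min {(m - σ)/m, (m - θ)/m}`. -/
def gammaZero (σ m θ : ℝ) : ℝ :=
  min ((m - σ) / m) ((m - θ) / m)

end

open MeasureTheory Set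

/-! ### Oscillation and reachable points -/

/-! The coercive gradient term beats the nonlocal one. Around x ∈ Ω, u is compared with u(x) +
L·`barrier`, where the barrier vanishes at x, has a tip |v|^γ₀ there and blows up on the sphere of
radius R = 5d(x)/6. If u exceeded this somewhere, u(x+·) − L·`barrier` would have an interior
maximum at some v ≠ 0 (`exists_max_sub_barrier`). There a paraboloid with gradient p and quadratic
coefficient c touches u from above (`barrier_add_le`). With τ = min(|v|, R(1 − |v|²/R²)),
`barrier_gradient_bounds` gives |p| ≥ Lγ₀τ^(γ₀−1) and c ≤ (80/γ₀)|p|/τ.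

Testing the equation with the paraboloid and cutting the jumps at a size δ proportional to τ
(`IsViscositySubsolution.norm_rpow_le`) bounds b₀|p|^m by terms of order τ^(−θ), osc(u)τ^(−σ) and
|p|τ^(σ/m−σ). Since γ₀ − 1 = −max(σ,θ)/m, taking L a large multiple of 1 + osc(u) makes b₀|p|^m
larger than all of them (`exists_coercive_dominates`), a contradiction. This is
`exists_barrier_bound`; exchanging the two points gives `exists_interior_holder`, with a constant
that does not degenerate at the boundary.

That uniformity gives the global estimate. Near the boundary, Ω contains cones with a locally common
axis (`HasC11Boundary.exists_cones`). Two close points are each moved along this axis to a height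
comparable to their distance; a geometric series controls the change of u (`abs_sub_le_along_ray`),
and the raised points are compared by the interior estimate. McShane's formula then extends u to the
closure. -/

theorem abs_sub_le_osc {N : ℕ} {S : Set (RN N)} {u : RN N → ℝ} (hu : ∃ M : ℝ, ∀ x, |u x| ≤ M)
    {x y : RN N} (hx : x ∈ S) (hy : y ∈ S) : |u x - u y| ≤ osc S u := by
  obtain ⟨M, hM⟩ := hu
  have ha : BddAbove (u '' S) := ⟨M, by rintro _ ⟨z, -, rfl⟩; exact (abs_le.1 (hM z)).2⟩
  have hb : BddBelow (u '' S) := ⟨-M, by rintro _ ⟨z, -, rfl⟩; exact (abs_le.1 (hM z)).1⟩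
  have h1 := le_csSup ha (mem_image_of_mem u hx)
  have h2 := le_csSup ha (mem_image_of_mem u hy)
  have h3 := csInf_le hb (mem_image_of_mem u hx)
  have h4 := csInf_le hb (mem_image_of_mem u hy)
  unfold osc
  rw [abs_le]
  constructor <;> linarith

/-- The support of a measure on a second countable space has full measure, so almost every jump is
controlled by the oscillation over the reachable set. -/
theorem ae_add_mem_reachableSet {N : ℕ} {Ω : Set (RN N)} (ν : Measure (RN N))
    {j : RN N → RN N → RN N} {x : RN N} (hj : Measurable (j x)) (hx : x ∈ closure Ω) :
    ∀ᵐ z ∂ν, x + j x z ∈ reachableSet Ω ν j := by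
  have h : ∀ᵐ w ∂(pushMeasure ν j x), w ∈ (pushMeasure ν j x).support :=
    Measure.support_mem_ae
  filter_upwards [ae_of_ae_map hj.aemeasurable h] with z hz
  exact Or.inr (mem_iUnion₂.2 ⟨x, hx, j x z, hz, rfl⟩)

/-! ### Quadratic test functions -/

/-- The quadratic polynomial `⟨p, y' - y⟩ + c |y' - y|²`. -/
noncomputable def quadTest {N : ℕ} (y p : RN N) (c : ℝ) (y' : RN N) : ℝ :=
  inner ℝ p (y' - y) + c * ‖y' - y‖ ^ 2

theorem contDiff_quadTest {N : ℕ} (y p : RN N) (c : ℝ) : ContDiff ℝ 2 (quadTest y p c) := by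
  have h : ContDiff ℝ 2 (fun y' : RN N => y' - y) := contDiff_id.sub contDiff_const
  exact (contDiff_const.inner ℝ h).add (contDiff_const.mul (h.norm_sq ℝ))

theorem gradient_quadTest {N : ℕ} (y p : RN N) (c : ℝ) : gradient (quadTest y p c) y = p := by
  apply HasGradientAt.gradient
  rw [hasGradientAt_iff_hasFDerivAt]
  have h : HasFDerivAt (fun y' : RN N => y' - y) (ContinuousLinearMap.id ℝ (RN N)) y :=
    (hasFDerivAt_id y).sub_const y
  have h1 := ((hasFDerivAt_const p y).inner ℝ h).add ((h.norm_sq).const_mul c)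
  refine h1.congr_fderiv ?_
  ext v
  simp [fderivInnerCLM_apply]

theorem quadTest_add_sub {N : ℕ} (y p h : RN N) (c : ℝ) :
    quadTest y p c (y + h) - quadTest y p c y = inner ℝ p h + c * ‖h‖ ^ 2 := by
  simp [quadTest]

/-! ### Bounds for the nonlocal operator -/

/-- Integrability of f is not needed: otherwise the Bochner integral is 0, which is at most c. -/
theorem integral_le_of_lintegral_le {α : Type*} [MeasurableSpace α] {μ : Measure α} {f : α → ℝ}
    {c : ℝ} (hc : 0 ≤ c) (h : ∫⁻ z, ENNReal.ofReal |f z| ∂μ ≤ ENNReal.ofReal c) :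
    ∫ z, f z ∂μ ≤ c := by
  refine (le_abs_self _).trans ((norm_integral_le_lintegral_norm f).trans ?_)
  exact ENNReal.toReal_le_of_le_ofReal hc h

theorem hFun_of_lt {α σ : ℝ} (h : α < σ) (δ : ℝ) : hFun α σ δ = δ ^ (α - σ) := by
  simp [hFun, h]

theorem CondM1.lintegral_le {N : ℕ} {σ : ℝ} {K : ℝ → ℝ} {ν : Measure (RN N)} (h : CondM1 σ K ν)
    {α δ : ℝ} (hα : α ∈ Icc (0 : ℝ) 2) (hασ : α < σ) (hδ : 0 < δ) :
    ∫⁻ z in (Metric.ball (0 : RN N) δ)ᶜ, ENNReal.ofReal (min 1 (‖z‖ ^ α)) ∂ν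
      ≤ ENNReal.ofReal (|K α| * δ ^ (α - σ)) := by
  refine (h α hα δ hδ).trans (ENNReal.ofReal_le_ofReal ?_)
  rw [hFun_of_lt hασ]
  exact mul_le_mul_of_nonneg_right (le_abs_self _) (Real.rpow_nonneg hδ.le _)

theorem CondM2.lintegral_le {N : ℕ} {σ : ℝ} {K : ℝ → ℝ} {ν : Measure (RN N)} (h : CondM2 σ K ν)
    {α δ : ℝ} (hα : α ∈ Ioc σ 2) (hδ : δ ∈ Ioo (0 : ℝ) 1) :
    ∫⁻ z in Metric.ball (0 : RN N) δ, ENNReal.ofReal (‖z‖ ^ α) ∂ν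
      ≤ ENNReal.ofReal (|K α| * δ ^ (α - σ)) := by
  refine (h α hα δ hδ).trans (ENNReal.ofReal_le_ofReal ?_)
  exact mul_le_mul_of_nonneg_right (le_abs_self _) (Real.rpow_nonneg hδ.1.le _)

theorem lintegral_two_terms_le {α : Type*} [MeasurableSpace α] {μ : Measure α} {f g h : α → ℝ}
    {a b A B : ℝ} (hg : Measurable g) (ha : 0 ≤ a) (hb : 0 ≤ b) (hA : 0 ≤ A) (hB : 0 ≤ B)
    (hg0 : ∀ z, 0 ≤ g z) (hh0 : ∀ z, 0 ≤ h z)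
    (hf : ∀ᵐ z ∂μ, |f z| ≤ a * g z + b * h z)
    (h1 : ∫⁻ z, ENNReal.ofReal (g z) ∂μ ≤ ENNReal.ofReal A)
    (h2 : ∫⁻ z, ENNReal.ofReal (h z) ∂μ ≤ ENNReal.ofReal B) :
    ∫ z, f z ∂μ ≤ a * A + b * B := by
  refine integral_le_of_lintegral_le (by positivity) ?_
  calc ∫⁻ z, ENNReal.ofReal |f z| ∂μ
      ≤ ∫⁻ z, (ENNReal.ofReal a * ENNReal.ofReal (g z) +
          ENNReal.ofReal b * ENNReal.ofReal (h z)) ∂μ := by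
        refine lintegral_mono_ae ?_
        filter_upwards [hf] with z hz
        rw [← ENNReal.ofReal_mul ha, ← ENNReal.ofReal_mul hb,
          ← ENNReal.ofReal_add (mul_nonneg ha (hg0 z)) (mul_nonneg hb (hh0 z))]
        exact ENNReal.ofReal_le_ofReal hz
    _ = ENNReal.ofReal a * ∫⁻ z, ENNReal.ofReal (g z) ∂μ +
          ENNReal.ofReal b * ∫⁻ z, ENNReal.ofReal (h z) ∂μ := by
        rw [lintegral_add_left (by fun_prop), lintegral_const_mul' _ _ ENNReal.ofReal_ne_top,
          lintegral_const_mul' _ _ ENNReal.ofReal_ne_top]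
    _ ≤ ENNReal.ofReal a * ENNReal.ofReal A + ENNReal.ofReal b * ENNReal.ofReal B := by gcongr
    _ = ENNReal.ofReal (a * A + b * B) := by
        rw [← ENNReal.ofReal_mul ha, ← ENNReal.ofReal_mul hb, ← ENNReal.ofReal_add] <;> positivity

theorem levyIto_ball_quadTest_le {N : ℕ} {σ : ℝ} (hσ : σ ∈ Ioo (0 : ℝ) 2) {K : ℝ → ℝ} {Cj : ℝ}
    (hCj : 0 < Cj) {ν : Measure (RN N)} {j : RN N → RN N → RN N} (h2 : CondM2 σ K ν)
    (hj : CondJ1 Cj j) (y p : RN N) {c δ : ℝ} (hc : 0 ≤ c) (hδ : δ ∈ Ioo (0 : ℝ) 1) :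
    levyIto σ ν j (Metric.ball 0 δ) (quadTest y p c) y p ≤
      c * Cj ^ 2 * (|K 2| * δ ^ (2 - σ)) + ‖p‖ * Cj * (|K 1| * δ ^ (1 - σ)) := by
  have hK : ∀ α : ℝ, 0 ≤ |K α| * δ ^ (α - σ) := fun α =>
    mul_nonneg (abs_nonneg _) (Real.rpow_nonneg hδ.1.le _)
  have hq : ∀ z, c * ‖j y z‖ ^ 2 ≤ c * Cj ^ 2 * ‖z‖ ^ (2 : ℝ) := fun z => by
    rw [Real.rpow_two, mul_assoc, ← mul_pow]
    gcongr
    exact hj.2 y z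
  have hl : ∀ z, |inner ℝ p (j y z)| ≤ ‖p‖ * Cj * ‖z‖ ^ (1 : ℝ) := fun z => by
    rw [Real.rpow_one, mul_assoc]
    refine (abs_real_inner_le_norm _ _).trans ?_
    gcongr
    exact hj.2 y z
  have hm2 := h2.lintegral_le (α := 2) ⟨hσ.2, le_rfl⟩ hδ
  unfold levyIto
  by_cases h1 : 1 ≤ σ
  -- For σ ≥ 1 the compensator cancels the linear part exactly, because δ < 1; the second term is
  -- then taken to be zero.
  · have h0 : ∫⁻ z in Metric.ball (0 : RN N) δ, ENNReal.ofReal ((fun _ => (0 : ℝ)) z) ∂ν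
        ≤ ENNReal.ofReal (|K 1| * δ ^ (1 - σ)) := by simp
    refine lintegral_two_terms_le (g := fun z : RN N => ‖z‖ ^ (2 : ℝ)) (h := fun _ => 0)
      (by fun_prop) (by positivity) (by positivity) (hK 2) (hK 1) (fun z => by positivity)
      (fun z => le_rfl) ?_ hm2 h0
    refine (ae_restrict_iff' measurableSet_ball).2 (Filter.Eventually.of_forall fun z hz => ?_)
    have hz1 : ‖z‖ < 1 := (mem_ball_zero_iff.1 hz).trans hδ.2
    rw [quadTest_add_sub, if_pos ⟨h1, hz1⟩, add_sub_cancel_left, abs_of_nonneg (by positivity)]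
    simpa using hq z
  -- For σ < 1 there is no compensator, but |z| is integrable near 0 by (M2) with exponent 1 > σ.
  · have hm1 := h2.lintegral_le (α := 1) ⟨not_le.1 h1, by norm_num⟩ hδ
    refine lintegral_two_terms_le (g := fun z : RN N => ‖z‖ ^ (2 : ℝ))
      (h := fun z : RN N => ‖z‖ ^ (1 : ℝ))
      (by fun_prop) (by positivity) (by positivity) (hK 2) (hK 1) (fun z => by positivity)
      (fun z => by positivity) ?_ hm2 hm1
    refine Filter.Eventually.of_forall fun z => ?_
    rw [quadTest_add_sub, if_neg (fun h => h1 h.1), sub_zero, add_comm]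
    refine (abs_add_le _ _).trans (add_le_add ?_ (hl z))
    rw [abs_of_nonneg (by positivity)]
    exact hq z

/-- The compensator lives on |z| < 1, where |z| ≤ |z|^a for a ≤ 1. Keeping a strictly below σ covers
all σ at once and avoids the logarithm of (M1) at α = σ. -/
theorem levyIto_compl_ball_le {N : ℕ} {σ a : ℝ} (hσ : σ ∈ Ioo (0 : ℝ) 2) (ha : a ∈ Icc (0 : ℝ) 1)
    (haσ : a < σ) {K : ℝ → ℝ} {Cj : ℝ}
    (hCj : 0 < Cj) {ν : Measure (RN N)} {j : RN N → RN N → RN N} (h1 : CondM1 σ K ν)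
    (hj : CondJ1 Cj j) {Ω : Set (RN N)} {u : RN N → ℝ} (hu : ∃ M : ℝ, ∀ x, |u x| ≤ M)
    {y : RN N} (hy : y ∈ Ω) (p : RN N) {δ : ℝ} (hδ : 0 < δ) :
    levyIto σ ν j (Metric.ball 0 δ)ᶜ u y p ≤
      osc (reachableSet Ω ν j) u * (|K 0| * δ ^ (0 - σ)) +
        ‖p‖ * Cj * (|K a| * δ ^ (a - σ)) := by
  have hK : ∀ α : ℝ, 0 ≤ |K α| * δ ^ (α - σ) := fun α =>
    mul_nonneg (abs_nonneg _) (Real.rpow_nonneg hδ.le _)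
  have hyr : y ∈ reachableSet Ω ν j := Or.inl hy
  have hosc : 0 ≤ osc (reachableSet Ω ν j) u :=
    (abs_nonneg _).trans (abs_sub_le_osc hu hyr hyr)
  refine lintegral_two_terms_le (g := fun z : RN N => min 1 (‖z‖ ^ (0 : ℝ)))
    (h := fun z : RN N => min 1 (‖z‖ ^ a)) (by fun_prop) hosc (by positivity) (hK 0) (hK a)
    (fun z => by positivity) (fun z => by positivity) ?_
    (h1.lintegral_le (by norm_num) hσ.1 hδ)
    (h1.lintegral_le ⟨ha.1, ha.2.trans one_le_two⟩ haσ hδ)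
  refine ae_restrict_of_ae ?_
  filter_upwards [ae_add_mem_reachableSet ν (hj.1 y) (subset_closure hy)] with z hz
  refine (abs_sub _ _).trans (add_le_add ?_ ?_)
  · simpa using abs_sub_le_osc hu hz hyr
  · split_ifs with h
    · refine (abs_real_inner_le_norm _ _).trans ?_
      rw [mul_assoc]
      gcongr
      refine (hj.2 y z).trans ?_
      gcongr
      refine le_min h.2.le ?_
      calc ‖z‖ = ‖z‖ ^ (1 : ℝ) := (Real.rpow_one _).symm
        _ ≤ ‖z‖ ^ a := Real.rpow_le_rpow_of_exponent_ge' (norm_nonneg z) h.2.le ha.1 ha.2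
    · rw [abs_zero]; positivity

/-- A paraboloid is C² on the whole space and only has to touch u locally, so the singular barrier
itself is never used as a test function. -/
theorem IsViscositySubsolution.norm_rpow_le {N : ℕ} {σ m θ A b₀ a : ℝ} (hσ : σ ∈ Ioo (0 : ℝ) 2)
    (ha : a ∈ Icc (0 : ℝ) 1) (haσ : a < σ) {K₁ K₂ : ℝ → ℝ} {Cj : ℝ} (hCj : 0 < Cj)
    {ν : Measure (RN N)} {j : RN N → RN N → RN N} (h1 : CondM1 σ K₁ ν) (h2 : CondM2 σ K₂ ν)
    (hj : CondJ1 Cj j) {Ω : Set (RN N)} {u : RN N → ℝ} (hu : ∃ M : ℝ, ∀ x, |u x| ≤ M)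
    (hsub : IsViscositySubsolution σ m θ A b₀ ν j Ω u)
    {y : RN N} (hy : y ∈ Ω) {p : RN N} {c ρ δ : ℝ} (hc : 0 ≤ c) (hδ : δ ∈ Ioo (0 : ℝ) 1)
    (hρ : Cj * δ ≤ ρ)
    (htouch : ∀ h : RN N, ‖h‖ < ρ → u (y + h) ≤ u y + inner ℝ p h + c * ‖h‖ ^ 2) :
    b₀ * ‖p‖ ^ m ≤ A * bdryDist Ω y ^ (-θ) +
      (osc (reachableSet Ω ν j) u * (|K₁ 0| * δ ^ (0 - σ)) +
        ‖p‖ * Cj * (|K₁ a| * δ ^ (a - σ))) +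
      (c * Cj ^ 2 * (|K₂ 2| * δ ^ (2 - σ)) + ‖p‖ * Cj * (|K₂ 1| * δ ^ (1 - σ))) := by
  have hρ0 : 0 < ρ := lt_of_lt_of_le (mul_pos hCj hδ.1) hρ
  have key := hsub.2 y hy (quadTest y p c) (contDiff_quadTest y p c) ρ hρ0 ?_ δ hδ.1 ?_
  · rw [gradient_quadTest] at key
    have e1 := levyIto_ball_quadTest_le hσ hCj h2 hj y p hc hδ
    have e2 := levyIto_compl_ball_le hσ ha haσ hCj h1 hj hu hy p hδ.1
    linarith
  · intro y' hy'
    have hn : ‖y' - y‖ < ρ := by rwa [mem_ball_iff_norm] at hy'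
    have h3 := htouch (y' - y) hn
    have h4 := quadTest_add_sub y p (y' - y) c
    rw [add_sub_cancel] at h3 h4
    linarith
  · intro z hz
    rw [mem_ball_zero_iff] at hz
    rw [mem_ball_iff_norm, add_sub_cancel_left]
    exact ((hj.2 y z).trans_lt (mul_lt_mul_of_pos_left hz hCj)).trans_le hρ

/-! ### The barrier -/

/-- The radial barrier centred at `0`, with a Hölder tip at the origin and blowing up on the
sphere of radius `R`. -/
noncomputable def barrier {N : ℕ} (γ R : ℝ) (v : RN N) : ℝ :=
  ‖v‖ ^ γ + R ^ γ * ((1 - ‖v‖ ^ 2 / R ^ 2)⁻¹ - 1)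

theorem rpow_le_tangent {t t₀ k : ℝ} (ht : 0 ≤ t) (ht₀ : 0 < t₀) (hk : k ∈ Icc (0 : ℝ) 1) :
    t ^ k ≤ t₀ ^ k + k * t₀ ^ (k - 1) * (t - t₀) := by
  have h := rpow_one_add_le_one_add_mul_self (s := t / t₀ - 1)
    (by have : 0 ≤ t / t₀ := by positivity
        linarith) hk.1 hk.2
  rw [add_sub_cancel, Real.div_rpow ht ht₀.le, div_le_iff₀ (by positivity)] at h
  refine h.trans (le_of_eq ?_)
  rw [Real.rpow_sub_one ht₀.ne']
  field_simp

/-- |v + h|^γ is the concave power γ/2 of |v + h|², hence lies below its tangent in that variable.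
No smallness of h is needed, even across the tip. -/
theorem norm_add_rpow_le {N : ℕ} {γ : ℝ} (hγ : γ ∈ Ioo (0 : ℝ) 1) {v : RN N} (hv : v ≠ 0)
    (h : RN N) :
    ‖v + h‖ ^ γ ≤ ‖v‖ ^ γ + γ * ‖v‖ ^ (γ - 2) * inner ℝ v h +
      γ / 2 * ‖v‖ ^ (γ - 2) * ‖h‖ ^ 2 := by
  have h0 : 0 < ‖v‖ := norm_pos_iff.2 hv
  have e : ∀ (r k : ℝ), 0 ≤ r → (r ^ 2) ^ k = r ^ (2 * k) := fun r k hr => by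
    rw [← Real.rpow_two, ← Real.rpow_mul hr]
  have := rpow_le_tangent (t := ‖v + h‖ ^ 2) (t₀ := ‖v‖ ^ 2) (k := γ / 2) (by positivity)
    (by positivity) ⟨by linarith [hγ.1], by linarith [hγ.2]⟩
  rw [e _ _ (norm_nonneg _), e _ _ h0.le, e _ _ h0.le, norm_add_sq_real] at this
  rw [show 2 * (γ / 2) = γ by ring, show 2 * (γ / 2 - 1) = γ - 2 by ring] at this
  linarith

/-- Second-order Taylor bound for s ↦ 1/(1 − s), with remainder constant 2 as long as 1 − s loses at
most half of its value. -/
theorem inv_one_sub_le {S S' : ℝ} (hS : S < 1) (h : |S' - S| ≤ (1 - S) / 2) :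
    (1 - S')⁻¹ ≤ (1 - S)⁻¹ + (S' - S) / (1 - S) ^ 2 + 2 * (S' - S) ^ 2 / (1 - S) ^ 3 := by
  have h1 : 0 < 1 - S := by linarith
  have h2 : (1 - S) / 2 ≤ 1 - S' := by linarith [(abs_le.1 h).2]
  have h3 : 0 < 1 - S' := by linarith
  have e : (1 - S)⁻¹ + (S' - S) / (1 - S) ^ 2 + 2 * (S' - S) ^ 2 / (1 - S) ^ 3 - (1 - S')⁻¹ =
      (S' - S) ^ 2 * (2 * (1 - S') - (1 - S)) / ((1 - S) ^ 3 * (1 - S')) := by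
    field_simp
    ring
  have : 0 ≤ (S' - S) ^ 2 * (2 * (1 - S') - (1 - S)) / ((1 - S) ^ 3 * (1 - S')) := by
    have : 0 ≤ 2 * (1 - S') - (1 - S) := by linarith
    positivity
  linarith

theorem abs_norm_add_sq_sub_le {N : ℕ} {R : ℝ} {v h : RN N} (hv : ‖v‖ < R)
    (hh : ‖h‖ < R * (1 - ‖v‖ ^ 2 / R ^ 2) / 6) :
    |‖v + h‖ ^ 2 / R ^ 2 - ‖v‖ ^ 2 / R ^ 2| ≤ 3 * ‖h‖ / R ∧
      3 * ‖h‖ / R ≤ (1 - ‖v‖ ^ 2 / R ^ 2) / 2 := by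
  have hR : 0 < R := (norm_nonneg v).trans_lt hv
  have hhR : ‖h‖ ≤ R := by
    have : 0 ≤ R * (‖v‖ ^ 2 / R ^ 2) := by positivity
    nlinarith
  constructor
  · rw [← sub_div, abs_div, abs_of_pos (pow_pos hR 2), div_le_div_iff₀ (pow_pos hR 2) hR,
      norm_add_sq_real]
    have h1 := abs_real_inner_le_norm v h
    have h2 : |‖v‖ ^ 2 + 2 * inner ℝ v h + ‖h‖ ^ 2 - ‖v‖ ^ 2| ≤ 2 * (‖v‖ * ‖h‖) + ‖h‖ * ‖h‖ := by
      rw [show ‖v‖ ^ 2 + 2 * inner ℝ v h + ‖h‖ ^ 2 - ‖v‖ ^ 2 = 2 * inner ℝ v h + ‖h‖ * ‖h‖ by ring]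
      refine (abs_add_le _ _).trans (add_le_add ?_ (by rw [abs_of_nonneg (by positivity)]))
      rw [abs_mul, abs_two]
      linarith
    have h3 : 2 * (‖v‖ * ‖h‖) + ‖h‖ * ‖h‖ ≤ 3 * ‖h‖ * R := by
      nlinarith [norm_nonneg h, mul_le_mul_of_nonneg_right hv.le (norm_nonneg h),
        mul_le_mul_of_nonneg_right hhR (norm_nonneg h)]
    nlinarith
  · rw [div_le_iff₀ hR]
    linarith

theorem norm_add_lt_of_norm_lt {N : ℕ} {R : ℝ} {v h : RN N} (hv : ‖v‖ < R)
    (hh : ‖h‖ < R * (1 - ‖v‖ ^ 2 / R ^ 2) / 6) : ‖v + h‖ < R := by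
  have hR : 0 < R := (norm_nonneg v).trans_lt hv
  have hS : ‖v‖ ^ 2 / R ^ 2 < 1 := by
    rw [div_lt_one (by positivity)]; gcongr
  obtain ⟨h1, h2⟩ := abs_norm_add_sq_sub_le hv hh
  have h3 : ‖v + h‖ ^ 2 / R ^ 2 < 1 := by
    have := (abs_le.1 h1).2
    linarith
  rw [div_lt_one (by positivity)] at h3
  exact lt_of_pow_lt_pow_left₀ 2 hR.le h3

theorem barrier_add_le {N : ℕ} {γ R : ℝ} (hγ : γ ∈ Ioo (0 : ℝ) 1) {v h : RN N} (hv0 : v ≠ 0)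
    (hv : ‖v‖ < R) (hh : ‖h‖ < R * (1 - ‖v‖ ^ 2 / R ^ 2) / 6) :
    barrier γ R (v + h) ≤ barrier γ R v +
      inner ℝ ((γ * ‖v‖ ^ (γ - 2) + 2 * (R ^ γ / R ^ 2) / (1 - ‖v‖ ^ 2 / R ^ 2) ^ 2) • v) h +
      (γ / 2 * ‖v‖ ^ (γ - 2) + R ^ γ / R ^ 2 / (1 - ‖v‖ ^ 2 / R ^ 2) ^ 2 +
        18 * (R ^ γ / R ^ 2) / (1 - ‖v‖ ^ 2 / R ^ 2) ^ 3) * ‖h‖ ^ 2 := by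
  have hR : 0 < R := (norm_nonneg v).trans_lt hv
  have hS : ‖v‖ ^ 2 / R ^ 2 < 1 := by
    rw [div_lt_one (by positivity)]; gcongr
  obtain ⟨h1, h2⟩ := abs_norm_add_sq_sub_le hv hh
  have k1 := norm_add_rpow_le hγ hv0 h
  have k2 := inv_one_sub_le hS (h1.trans h2)
  have k3 : ‖v + h‖ ^ 2 / R ^ 2 - ‖v‖ ^ 2 / R ^ 2 = (2 * inner ℝ v h + ‖h‖ ^ 2) / R ^ 2 := by
    rw [norm_add_sq_real]; ring
  have k4 : (‖v + h‖ ^ 2 / R ^ 2 - ‖v‖ ^ 2 / R ^ 2) ^ 2 ≤ 9 * ‖h‖ ^ 2 / R ^ 2 := by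
    calc _ = |‖v + h‖ ^ 2 / R ^ 2 - ‖v‖ ^ 2 / R ^ 2| ^ 2 := (sq_abs _).symm
      _ ≤ (3 * ‖h‖ / R) ^ 2 := by gcongr
      _ = 9 * ‖h‖ ^ 2 / R ^ 2 := by ring
  unfold barrier
  rw [inner_smul_left]
  simp only [conj_trivial]
  set e := 1 - ‖v‖ ^ 2 / R ^ 2 with he
  have he0 : 0 < e := by linarith
  have k5 : (1 - ‖v + h‖ ^ 2 / R ^ 2)⁻¹ ≤ e⁻¹ + (2 * inner ℝ v h + ‖h‖ ^ 2) / R ^ 2 / e ^ 2 +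
      2 * (9 * ‖h‖ ^ 2 / R ^ 2) / e ^ 3 := by
    refine k2.trans ?_
    rw [k3] at k4 ⊢
    gcongr
  have k6 := mul_le_mul_of_nonneg_left k5 (Real.rpow_nonneg hR.le γ)
  have e1 : R ^ γ * (e⁻¹ + (2 * inner ℝ v h + ‖h‖ ^ 2) / R ^ 2 / e ^ 2 +
      2 * (9 * ‖h‖ ^ 2 / R ^ 2) / e ^ 3) = R ^ γ * e⁻¹ +
      (2 * (R ^ γ / R ^ 2) / e ^ 2) * inner ℝ v h +
      (R ^ γ / R ^ 2 / e ^ 2 + 18 * (R ^ γ / R ^ 2) / e ^ 3) * ‖h‖ ^ 2 := by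
    ring
  rw [e1] at k6
  linarith

/-- τ measures the distance to both singularities. The tip term governs the gradient when |v| is the
minimum, the blow-up term when R·e is, and one derivative costs a factor 1/τ in either regime. -/
theorem barrier_gradient_bounds {γ R d τ e G : ℝ} (hγ : γ ∈ Ioo (0 : ℝ) 1) (hd : 0 < d)
    (hdR : d < R) (he : e = 1 - d ^ 2 / R ^ 2) (hτ : τ = min d (R * e))
    (hG : G = (γ * d ^ (γ - 2) + 2 * (R ^ γ / R ^ 2) / e ^ 2) * d) :
    0 < τ ∧ γ * τ ^ (γ - 1) ≤ G ∧
      γ / 2 * d ^ (γ - 2) + R ^ γ / R ^ 2 / e ^ 2 + 18 * (R ^ γ / R ^ 2) / e ^ 3 ≤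
        80 / γ * (G / τ) := by
  obtain ⟨hγ0, hγ1⟩ := hγ
  have hR : 0 < R := hd.trans hdR
  have he0 : 0 < e := by
    rw [he, sub_pos, div_lt_one (by positivity)]; gcongr
  have he1 : e ≤ 1 := by
    have : 0 ≤ d ^ 2 / R ^ 2 := by positivity
    linarith
  have hτ0 : 0 < τ := by rw [hτ]; exact lt_min hd (by positivity)
  have hτd : τ ≤ d := hτ ▸ min_le_left _ _
  have hτR : τ ≤ R * e := hτ ▸ min_le_right _ _
  have hk : 0 < R ^ γ / R ^ 2 := by positivity
  have hG1 : γ * d ^ (γ - 2) * d ≤ G := by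
    rw [hG]
    refine mul_le_mul_of_nonneg_right ?_ hd.le
    have : 0 ≤ 2 * (R ^ γ / R ^ 2) / e ^ 2 := by positivity
    linarith
  have hG2 : 2 * (R ^ γ / R ^ 2) / e ^ 2 * d ≤ G := by
    rw [hG]
    refine mul_le_mul_of_nonneg_right ?_ hd.le
    have : 0 ≤ γ * d ^ (γ - 2) := by positivity
    linarith
  have hG0 : 0 < G := lt_of_lt_of_le (by positivity) hG1
  have hfar : d < R / 2 → 3 / 4 ≤ e := fun h => by
    have : d ^ 2 / R ^ 2 ≤ 1 / 4 := by
      rw [div_le_iff₀ (by positivity)]; nlinarith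
    linarith
  have hpow : d ^ (γ - 2) * d = d ^ (γ - 1) := by
    rw [← Real.rpow_add_one hd.ne']; congr 1; ring
  refine ⟨hτ0, ?_, ?_⟩
  · rcases le_total d (R * e) with h | h
    · rw [hτ, min_eq_left h, ← hpow, ← mul_assoc]
      exact hG1
    · rw [hτ, min_eq_right h]
      -- If d < R/2 then e ≥ 3/4, and R·e would exceed d.
      have hd2 : R / 2 ≤ d := by
        by_contra hcon
        have := hfar (not_le.1 hcon)
        nlinarith
      calc γ * (R * e) ^ (γ - 1) ≤ 1 * (R ^ (γ - 1) * e ^ (γ - 1)) := by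
            rw [Real.mul_rpow hR.le he0.le]; gcongr
        _ ≤ 1 * (R ^ (γ - 1) * e ^ (-2 : ℝ)) := by
            gcongr 1 * (_ * ?_)
            exact Real.rpow_le_rpow_of_exponent_ge he0 he1 (by linarith)
        _ = 2 * (R ^ γ / R ^ 2) / e ^ 2 * (R / 2) := by
            rw [Real.rpow_sub_one hR.ne', Real.rpow_neg he0.le, Real.rpow_two]
            field_simp
        _ ≤ 2 * (R ^ γ / R ^ 2) / e ^ 2 * d := by gcongr
        _ ≤ G := hG2
  · have t1 : γ / 2 * d ^ (γ - 2) ≤ 1 / γ * (G / τ) := by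
      have : γ * d ^ (γ - 2) ≤ G / τ := by
        rw [le_div_iff₀ hτ0]
        refine le_trans ?_ hG1
        gcongr
      have h1 : 1 ≤ 1 / γ := by rw [le_div_iff₀ hγ0]; linarith
      have h2 : 0 < G / τ := by positivity
      nlinarith
    have t2 : R ^ γ / R ^ 2 / e ^ 2 ≤ R ^ γ / R ^ 2 / e ^ 3 := by
      gcongr R ^ γ / R ^ 2 / ?_
      exact pow_le_pow_of_le_one he0.le he1 (by norm_num)
    have t3 : R ^ γ / R ^ 2 / e ^ 3 ≤ 3 / γ * (G / τ) := by
      rcases lt_or_ge d (R / 2) with h | h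
      · have h1 := hfar h
        have h2 : R ^ γ / R ^ 2 ≤ d ^ (γ - 2) := by
          rw [← Real.rpow_two, ← Real.rpow_sub hR]
          exact Real.rpow_le_rpow_of_nonpos hd hdR.le (by linarith)
        have h3 : R ^ γ / R ^ 2 / e ^ 3 ≤ 3 * d ^ (γ - 2) := by
          rw [div_le_iff₀ (by positivity)]
          have h4 : (3 / 4 : ℝ) ^ 3 ≤ e ^ 3 := by gcongr
          have h5 : 0 < d ^ (γ - 2) := by positivity
          nlinarith
        refine h3.trans ?_
        rw [div_mul_div_comm, le_div_iff₀ (by positivity)]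
        have h4 : γ * d ^ (γ - 2) * τ ≤ G := le_trans (by gcongr) hG1
        nlinarith
      · have h1 : R ^ γ / R ^ 2 / e ^ 3 ≤ G / (R * e) := by
          rw [le_div_iff₀ (by positivity)]
          refine le_trans ?_ hG2
          calc R ^ γ / R ^ 2 / e ^ 3 * (R * e) = 2 * (R ^ γ / R ^ 2) / e ^ 2 * (R / 2) := by
                field_simp
            _ ≤ 2 * (R ^ γ / R ^ 2) / e ^ 2 * d := by gcongr
        have h2 : G / (R * e) ≤ G / τ := by gcongr
        have h3 : 1 ≤ 3 / γ := by rw [le_div_iff₀ hγ0]; linarith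
        have h4 : 0 < G / τ := by positivity
        nlinarith
    -- The pieces add up to (1 + 3 + 18·3)/γ = 58/γ, below 80/γ.
    have t4 : 18 * (R ^ γ / R ^ 2) / e ^ 3 = 18 * (R ^ γ / R ^ 2 / e ^ 3) := by ring
    have t5 : 80 / γ * (G / τ) = 80 * (1 / γ * (G / τ)) := by ring
    have t6 : 3 / γ * (G / τ) = 3 * (1 / γ * (G / τ)) := by ring
    have t7 : 0 < 1 / γ * (G / τ) := by positivity
    linarith

/-! ### Distance to the boundary -/

/-- The ball is connected and misses the boundary, so it cannot meet both Ω and the exterior of Ω.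
-/
theorem ball_bdryDist_subset {N : ℕ} {Ω : Set (RN N)} (hΩ : IsOpen Ω) {x : RN N} (hx : x ∈ Ω) :
    Metric.ball x (bdryDist Ω x) ⊆ Ω := by
  have hfr : ∀ w ∈ Metric.ball x (bdryDist Ω x), w ∉ frontier Ω := fun w hw hwf => by
    have : bdryDist Ω x ≤ dist x w := Metric.infDist_le_dist_of_mem hwf
    rw [Metric.mem_ball'] at hw
    linarith
  intro y hy
  by_contra hyΩ
  have hpos : 0 < bdryDist Ω x := dist_nonneg.trans_lt hy
  have hcl : ∀ w ∈ Metric.ball x (bdryDist Ω x), w ∉ Ω → w ∉ closure Ω := fun w hw hwΩ hwc =>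
    hfr w hw (by rw [hΩ.frontier_eq]; exact ⟨hwc, hwΩ⟩)
  obtain ⟨w, -, hw1, hw2⟩ := (convex_ball x (bdryDist Ω x)).isPreconnected Ω (closure Ω)ᶜ hΩ
    isClosed_closure.isOpen_compl
    (fun w hw => by
      by_cases h : w ∈ Ω
      · exact Or.inl h
      · exact Or.inr (hcl w hw h))
    ⟨x, Metric.mem_ball_self hpos, hx⟩ ⟨y, hy, hcl y hy hyΩ⟩
  exact hw2 (subset_closure hw1)

theorem bdryDist_le_add_norm_sub {N : ℕ} (Ω : Set (RN N)) (x y : RN N) :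
    bdryDist Ω x ≤ bdryDist Ω y + ‖y - x‖ := by
  rw [← dist_eq_norm, dist_comm]
  exact Metric.infDist_le_infDist_add_dist

theorem exists_bdryDist_le {N : ℕ} {Ω : Set (RN N)} (hΩ : Bornology.IsBounded Ω) :
    ∃ D : ℝ, 1 ≤ D ∧ ∀ x ∈ Ω, bdryDist Ω x ≤ D := by
  rcases (frontier Ω).eq_empty_or_nonempty with h | ⟨f, hf⟩
  · exact ⟨1, le_rfl, fun x _ => by simp [bdryDist, h]⟩
  · obtain ⟨C, hC⟩ := (Metric.isBounded_iff_subset_closedBall f).1 hΩ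
    exact ⟨max 1 C, le_max_left _ _, fun x hx =>
      (Metric.infDist_le_dist_of_mem hf).trans ((hC hx).trans (le_max_right _ _))⟩

/-! ### The gradient power dominates -/

/-- Write P^m = P^(m−1)·P and use the lower bound on P in the first factor only: this gives M^(m−1)X
with X = P·q^(−(s/m)(m−1)). Each of the three terms is at most X, the last one because σ/m − σ =
−σ(m−1)/m; as m > 1, a large M wins. -/
theorem exists_coercive_dominates {C b₀ m s σ θ : ℝ} (hC : 0 ≤ C) (hb₀ : 0 < b₀) (hm : 1 < m)
    (hσs : σ ≤ s) (hθs : θ ≤ s) :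
    ∃ M : ℝ, 1 ≤ M ∧ ∀ q ω P : ℝ, 0 < q → q ≤ 1 → 0 ≤ ω → M * (1 + ω) * q ^ (-(s / m)) ≤ P →
      C * (q ^ (-θ) + ω * q ^ (-σ) + P * q ^ (σ / m - σ)) < b₀ * P ^ m := by
  have hm0 : 0 < m := by linarith
  have hlim := tendsto_rpow_atTop (y := m - 1) (by linarith)
  obtain ⟨M, hM1, hM2⟩ :=
    ((Filter.eventually_ge_atTop 1).and (hlim.eventually_gt_atTop (3 * C / b₀))).exists
  refine ⟨M, hM1, fun q ω P hq hq1 hω hP => ?_⟩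
  rw [div_lt_iff₀ hb₀] at hM2
  have hMP : M * q ^ (-(s / m)) ≤ P := by
    refine le_trans ?_ hP
    gcongr
    nlinarith
  have hωP : (1 + ω) * q ^ (-(s / m)) ≤ P := by
    refine le_trans ?_ hP
    gcongr
    nlinarith
  have hP0 : 0 < P := lt_of_lt_of_le (by positivity) hMP
  set X := P * q ^ (-(s / m) * (m - 1)) with hX
  have hX0 : 0 < X := by positivity
  have h1 : M ^ (m - 1) * X ≤ P ^ m := by
    calc M ^ (m - 1) * X = (M * q ^ (-(s / m))) ^ (m - 1) * P := by
          rw [Real.mul_rpow (by linarith) (by positivity), ← Real.rpow_mul hq.le, hX]; ring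
      _ ≤ P ^ (m - 1) * P := by gcongr
      _ = P ^ m := by rw [← Real.rpow_add_one hP0.ne']; congr 1; ring
  have hexp : ∀ k : ℝ, k ≤ s → q ^ (-k) ≤ q ^ (-(s / m)) * q ^ (-(s / m) * (m - 1)) := by
    intro k hk
    rw [← Real.rpow_add hq]
    apply Real.rpow_le_rpow_of_exponent_ge hq hq1
    have : -(s / m) + -(s / m) * (m - 1) = -s := by field_simp; ring
    linarith
  have hkX : (1 + ω) * (q ^ (-(s / m)) * q ^ (-(s / m) * (m - 1))) ≤ X := by
    rw [← mul_assoc, hX]; gcongr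
  have hpp : 0 ≤ q ^ (-(s / m)) * q ^ (-(s / m) * (m - 1)) := by positivity
  have h2 : q ^ (-θ) ≤ X := by nlinarith [hexp θ hθs]
  have h3 : ω * q ^ (-σ) ≤ X := by nlinarith [hexp σ hσs]
  have h4 : P * q ^ (σ / m - σ) ≤ X := by
    rw [hX]
    gcongr 1
    apply Real.rpow_le_rpow_of_exponent_ge hq hq1
    have e1 : -(s / m) * (m - 1) = -(s * ((m - 1) / m)) := by ring
    have e2 : σ / m - σ = -(σ * ((m - 1) / m)) := by field_simp; ring
    rw [e1, e2]
    have : 0 ≤ (m - 1) / m := div_nonneg (by linarith) hm0.le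
    exact neg_le_neg (mul_le_mul_of_nonneg_right hσs this)
  calc C * (q ^ (-θ) + ω * q ^ (-σ) + P * q ^ (σ / m - σ)) ≤ C * (3 * X) := by
        gcongr; linarith
    _ = 3 * C * X := by ring
    _ < M ^ (m - 1) * b₀ * X := by gcongr
    _ = b₀ * (M ^ (m - 1) * X) := by ring
    _ ≤ b₀ * P ^ m := by gcongr

/-- The bound c ≲ P/q turns the second-order term into one of order P·q^(1−σ), and q ≤ 1 with a ≤ 1
lets q^(a−σ) absorb it. -/
theorem exists_jump_terms_le {A σ θ a D κ γ Cj : ℝ} (hA : 0 < A) (hθ : 0 ≤ θ)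
    (ha : a ≤ 1) (hD : 0 < D) (hκ : 0 < κ) (hγ : 0 < γ) (hCj : 0 < Cj) (K₁ K₂ : ℝ → ℝ) :
    ∃ C : ℝ, 0 ≤ C ∧ ∀ q ω P c ℓ : ℝ, 0 < q → q ≤ 1 → 0 ≤ ω → 0 ≤ P →
      c ≤ 80 / γ * (P / (D * q)) → D * q / 5 ≤ ℓ →
      A * ℓ ^ (-θ) + (ω * (|K₁ 0| * (κ * q) ^ (0 - σ)) + P * Cj * (|K₁ a| * (κ * q) ^ (a - σ))) +
        (c * Cj ^ 2 * (|K₂ 2| * (κ * q) ^ (2 - σ)) + P * Cj * (|K₂ 1| * (κ * q) ^ (1 - σ))) ≤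
      C * (q ^ (-θ) + ω * q ^ (-σ) + P * q ^ (a - σ)) := by
  set c₁ := A * (D / 5) ^ (-θ) with hc₁
  set c₂ := |K₁ 0| * κ ^ (0 - σ) with hc₂
  set c₃ := Cj * (|K₁ a| * κ ^ (a - σ)) with hc₃
  set c₄ := 80 / γ / D * Cj ^ 2 * (|K₂ 2| * κ ^ (2 - σ)) with hc₄
  set c₅ := Cj * (|K₂ 1| * κ ^ (1 - σ)) with hc₅
  have p₁ : 0 ≤ c₁ := by positivity
  have p₂ : 0 ≤ c₂ := by positivity
  have p₃ : 0 ≤ c₃ := by positivity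
  have p₄ : 0 ≤ c₄ := by positivity
  have p₅ : 0 ≤ c₅ := by positivity
  refine ⟨c₁ + c₂ + c₃ + c₄ + c₅, by positivity, fun q ω P c ℓ hq hq1 hω hP hc hℓ => ?_⟩
  have hκq : ∀ k : ℝ, (κ * q) ^ k = κ ^ k * q ^ k := fun k => Real.mul_rpow hκ.le hq.le
  have h1q : q ^ (1 - σ) ≤ q ^ (a - σ) :=
    Real.rpow_le_rpow_of_exponent_ge hq hq1 (by linarith)
  have t1 : A * ℓ ^ (-θ) ≤ c₁ * q ^ (-θ) := by
    rw [hc₁, mul_assoc, ← Real.mul_rpow (by positivity) hq.le]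
    gcongr 1
    apply Real.rpow_le_rpow_of_nonpos (by positivity) _ (by linarith)
    linarith
  have t2 : ω * (|K₁ 0| * (κ * q) ^ (0 - σ)) = c₂ * (ω * q ^ (-σ)) := by
    rw [hκq, hc₂, zero_sub]; ring
  have t3 : P * Cj * (|K₁ a| * (κ * q) ^ (a - σ)) = c₃ * (P * q ^ (a - σ)) := by
    rw [hκq, hc₃]; ring
  have t4 : c * Cj ^ 2 * (|K₂ 2| * (κ * q) ^ (2 - σ)) ≤ c₄ * (P * q ^ (a - σ)) := by
    calc c * Cj ^ 2 * (|K₂ 2| * (κ * q) ^ (2 - σ))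
        ≤ 80 / γ * (P / (D * q)) * Cj ^ 2 * (|K₂ 2| * (κ * q) ^ (2 - σ)) := by gcongr
      _ = c₄ * (P * q ^ (1 - σ)) := by
          rw [hκq, hc₄, show (2 - σ) = (1 - σ) + 1 by ring, Real.rpow_add_one hq.ne' (1 - σ)]
          field_simp
      _ ≤ c₄ * (P * q ^ (a - σ)) := by gcongr
  have t5 : P * Cj * (|K₂ 1| * (κ * q) ^ (1 - σ)) ≤ c₅ * (P * q ^ (a - σ)) := by
    calc _ = c₅ * (P * q ^ (1 - σ)) := by rw [hκq, hc₅]; ring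
      _ ≤ _ := by gcongr
  have n1 : 0 ≤ q ^ (-θ) := by positivity
  have n2 : 0 ≤ ω * q ^ (-σ) := by positivity
  have n3 : 0 ≤ P * q ^ (a - σ) := by positivity
  have e : (c₁ + c₂ + c₃ + c₄ + c₅) * (q ^ (-θ) + ω * q ^ (-σ) + P * q ^ (a - σ)) =
      c₁ * q ^ (-θ) + c₂ * (ω * q ^ (-σ)) + (c₃ + c₄ + c₅) * (P * q ^ (a - σ)) +
      (c₂ + c₃ + c₄ + c₅) * q ^ (-θ) + (c₁ + c₃ + c₄ + c₅) * (ω * q ^ (-σ)) +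
      (c₁ + c₂) * (P * q ^ (a - σ)) := by ring
  rw [e]
  have r1 : 0 ≤ (c₂ + c₃ + c₄ + c₅) * q ^ (-θ) := by positivity
  have r2 : 0 ≤ (c₁ + c₃ + c₄ + c₅) * (ω * q ^ (-σ)) := by positivity
  have r3 : 0 ≤ (c₁ + c₂) * (P * q ^ (a - σ)) := by positivity
  linarith

/-! ### The interior estimate -/

theorem continuousOn_barrier {N : ℕ} {γ R : ℝ} (hγ : 0 < γ) :
    ContinuousOn (barrier (N := N) γ R) (Metric.ball 0 R) := by
  unfold barrier
  refine ContinuousOn.add ?_ (continuousOn_const.mul (ContinuousOn.sub ?_ continuousOn_const))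
  · exact (continuous_norm.continuousOn).rpow_const fun _ _ => Or.inr hγ.le
  · refine ContinuousOn.inv₀ (by fun_prop) fun v hv => ?_
    rw [mem_ball_zero_iff] at hv
    have hR : 0 < R := (norm_nonneg v).trans_lt hv
    have hS : ‖v‖ ^ 2 / R ^ 2 < 1 := by
      rw [div_lt_one (by positivity)]; gcongr
    linarith

theorem exists_lt_barrier {N : ℕ} {γ R : ℝ} (hR : 0 < R) (M : ℝ) :
    ∃ R' < R, ∀ v : RN N, R' < ‖v‖ → ‖v‖ < R → M < barrier γ R v := by
  set T := max 1 (M / R ^ γ + 2) with hT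
  have hT1 : 1 ≤ T := le_max_left _ _
  have hT2 : M / R ^ γ + 2 ≤ T := le_max_right _ _
  have hT0 : 0 < T := by linarith
  -- This is the radius at which (1 − |v|²/R²)⁻¹ equals T.
  refine ⟨R * Real.sqrt (1 - T⁻¹), ?_, fun v hv hvR => ?_⟩
  · have : Real.sqrt (1 - T⁻¹) < 1 := by
      rw [Real.sqrt_lt' one_pos]
      have : 0 < T⁻¹ := by positivity
      linarith
    nlinarith
  · have h0 : 0 ≤ 1 - T⁻¹ := by
      rw [sub_nonneg]; exact inv_le_one_of_one_le₀ hT1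
    have h1 : 1 - T⁻¹ < ‖v‖ ^ 2 / R ^ 2 := by
      rw [lt_div_iff₀ (by positivity)]
      calc (1 - T⁻¹) * R ^ 2 = (R * Real.sqrt (1 - T⁻¹)) ^ 2 := by
            rw [mul_pow, Real.sq_sqrt h0]; ring
        _ < ‖v‖ ^ 2 := by gcongr
    have hS : ‖v‖ ^ 2 / R ^ 2 < 1 := by
      rw [div_lt_one (by positivity)]; gcongr
    have h2 : T < (1 - ‖v‖ ^ 2 / R ^ 2)⁻¹ := by
      rw [lt_inv_comm₀ hT0 (by linarith)]; linarith
    have h3 : M / R ^ γ < (1 - ‖v‖ ^ 2 / R ^ 2)⁻¹ - 1 := by linarith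
    rw [div_lt_iff₀ (by positivity)] at h3
    unfold barrier
    have : 0 ≤ ‖v‖ ^ γ := by positivity
    linarith

theorem barrier_zero {N : ℕ} {γ R : ℝ} (hγ : 0 < γ) : barrier γ R (0 : RN N) = 0 := by
  simp [barrier, Real.zero_rpow hγ.ne']

/-- If a bounded upper semicontinuous function exceeds the barrier somewhere, the difference
attains its maximum away from the centre. -/
theorem exists_max_sub_barrier {N : ℕ} {Ω : Set (RN N)} {u : RN N → ℝ}
    (hu : ∃ M : ℝ, ∀ x, |u x| ≤ M) (husc : UpperSemicontinuousOn u Ω) {x : RN N} {γ R L : ℝ}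
    (hγ : 0 < γ) (hL : 0 < L) (hball : Metric.ball x R ⊆ Ω)
    {v₀ : RN N} (hv₀ : ‖v₀‖ < R) (hpos : u x + L * barrier γ R v₀ < u (x + v₀)) :
    ∃ v : RN N, v ≠ 0 ∧ ‖v‖ < R ∧ ∀ w : RN N, ‖w‖ < R →
      u (x + w) - L * barrier γ R w ≤ u (x + v) - L * barrier γ R v := by
  have hR : 0 < R := (norm_nonneg v₀).trans_lt hv₀
  obtain ⟨M, hM⟩ := hu
  obtain ⟨R', hR'R, hR'⟩ := exists_lt_barrier (N := N) (γ := γ) hR (2 * M / L)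
  have hout : ∀ w : RN N, R' < ‖w‖ → ‖w‖ < R → u (x + w) - L * barrier γ R w < u x := by
    intro w h1 h2
    have h3 := hR' w h1 h2
    rw [div_lt_iff₀ hL] at h3
    have h4 := (abs_le.1 (hM (x + w))).2
    have h5 := (abs_le.1 (hM x)).1
    linarith
  have hv₀' : ‖v₀‖ ≤ R' := by
    by_contra hcon
    have := hout v₀ (not_le.1 hcon) hv₀
    linarith
  have hsub : Metric.closedBall (0 : RN N) R' ⊆ Metric.ball 0 R :=
    Metric.closedBall_subset_ball hR'R
  have hu' : UpperSemicontinuousOn (fun w => u (x + w)) (Metric.closedBall (0 : RN N) R') := by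
    refine husc.comp (g := fun w : RN N => x + w) (by fun_prop) fun w hw => hball ?_
    simpa [mem_ball_iff_norm] using hsub hw
  have hb : UpperSemicontinuousOn (fun w : RN N => -(L * barrier γ R w))
      (Metric.closedBall (0 : RN N) R') :=
    (continuousOn_const.mul ((continuousOn_barrier hγ).mono hsub)).neg.upperSemicontinuousOn
  obtain ⟨v, hv, hmax⟩ := (hu'.add hb).exists_isMaxOn
    ⟨v₀, by simpa using hv₀'⟩ (isCompact_closedBall 0 R')
  have hv₀m : u (x + v₀) + -(L * barrier γ R v₀) ≤ u (x + v) + -(L * barrier γ R v) :=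
    hmax (by simpa using hv₀')
  refine ⟨v, ?_, by simpa using hsub hv, fun w hw => ?_⟩
  -- At v = 0 the difference equals u(x), strictly less than its value at v₀.
  · rintro rfl
    rw [barrier_zero hγ, add_zero] at hv₀m
    linarith
  · rcases le_or_gt ‖w‖ R' with h | h
    · have : u (x + w) + -(L * barrier γ R w) ≤ u (x + v) + -(L * barrier γ R v) :=
        hmax (by simpa using h)
      linarith
    · have := hout w h hw
      linarith

theorem exists_barrier_bound {N : ℕ} {Ω : Set (RN N)} (hΩo : IsOpen Ω)
    (hΩb : Bornology.IsBounded Ω) {A b₀ σ m θ γ : ℝ} (hA : 0 < A) (hb₀ : 0 < b₀)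
    (hσ : σ ∈ Ioo (0 : ℝ) 2) (hm1 : 1 < m) (hmσ : σ < m) (hθ : θ ∈ Ico (0 : ℝ) m)
    (hγ : γ = 1 - max σ θ / m) (K₁ K₂ : ℝ → ℝ) {Cj : ℝ} (hCj : 0 < Cj) :
    ∃ C : ℝ, 0 < C ∧ ∀ (ν : Measure (RN N)) (j : RN N → RN N → RN N),
      CondM1 σ K₁ ν → CondM2 σ K₂ ν → CondJ1 Cj j →
      ∀ u : RN N → ℝ, (∃ M : ℝ, ∀ x, |u x| ≤ M) →
        IsViscositySubsolution σ m θ A b₀ ν j Ω u →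
        ∀ x ∈ Ω, ∀ v : RN N, ‖v‖ < 5 / 6 * bdryDist Ω x →
          u (x + v) ≤ u x + C * (1 + osc (reachableSet Ω ν j) u) *
            barrier γ (5 / 6 * bdryDist Ω x) v := by
  have hm0 : 0 < m := by linarith
  have hs0 : 0 < max σ θ := hσ.1.trans_le (le_max_left _ _)
  have hsm : max σ θ < m := max_lt hmσ hθ.2
  have hγ' : γ ∈ Ioo (0 : ℝ) 1 := by
    rw [hγ]
    constructor
    · rw [sub_pos, div_lt_one hm0]; exact hsm
    · have : 0 < max σ θ / m := by positivity
      linarith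
  obtain ⟨D, hD1, hD⟩ := exists_bdryDist_le hΩb
  have hD0 : 0 < D := by linarith
  -- The first entry gives δ = κq < 1; the second keeps jumps from |z| < δ within τ/6, where the
  -- paraboloid touches.
  set κ := min (1 / 2) (D / (6 * Cj)) with hκ
  have hκ0 : 0 < κ := lt_min (by norm_num) (by positivity)
  have ha1 : σ / m ≤ 1 := by rw [div_le_one hm0]; exact hmσ.le
  have haσ : σ / m < σ := div_lt_self hσ.1 hm1
  obtain ⟨C₁, hC₁, hjump⟩ := exists_jump_terms_le (σ := σ) (θ := θ) (a := σ / m) (κ := κ) hA hθ.1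
    ha1 hD0 hκ0 hγ'.1 hCj K₁ K₂
  obtain ⟨M, hM1, hM⟩ := exists_coercive_dominates hC₁ hb₀ hm1 (le_max_left σ θ) (le_max_right σ θ)
  refine ⟨M * D ^ (max σ θ / m) / γ, by have := hγ'.1; positivity, ?_⟩
  intro ν j h1 h2 hj u hu hsub x hx v₀ hv₀
  by_contra! hcon
  set ω := osc (reachableSet Ω ν j) u with hω
  have hω0 : 0 ≤ ω := (abs_nonneg _).trans
    (abs_sub_le_osc hu (Or.inl hx : x ∈ reachableSet Ω ν j) (Or.inl hx))
  set R := 5 / 6 * bdryDist Ω x with hR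
  set L := M * D ^ (max σ θ / m) / γ * (1 + ω) with hL
  have hL0 : 0 < L := by have := hγ'.1; positivity
  have hR0 : 0 < R := (norm_nonneg _).trans_lt hv₀
  have hdx : bdryDist Ω x ≤ D := hD x hx
  have hball : Metric.ball x R ⊆ Ω :=
    (Metric.ball_subset_ball (by linarith)).trans (ball_bdryDist_subset hΩo hx)
  obtain ⟨v, hv0, hvR, hmax⟩ := exists_max_sub_barrier hu hsub.1 hγ'.1 hL0 hball hv₀ hcon
  have hd : 0 < ‖v‖ := norm_pos_iff.2 hv0
  obtain ⟨hτ0, hGτ, hcτ⟩ := barrier_gradient_bounds hγ' hd hvR rfl rfl rfl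
  set e := 1 - ‖v‖ ^ 2 / R ^ 2 with he
  set τ := min ‖v‖ (R * e) with hτ
  set g := γ * ‖v‖ ^ (γ - 2) + 2 * (R ^ γ / R ^ 2) / e ^ 2 with hg
  set c := γ / 2 * ‖v‖ ^ (γ - 2) + R ^ γ / R ^ 2 / e ^ 2 + 18 * (R ^ γ / R ^ 2) / e ^ 3 with hc
  have he0 : 0 < e := by
    have h : 0 < R * e := hτ0.trans_le (min_le_right _ _)
    exact pos_of_mul_pos_right h hR0.le
  have hg0 : 0 < g := by have := hγ'.1; positivity
  have hc0 : 0 < c := by have := hγ'.1; positivity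
  have hyΩ : x + v ∈ Ω := hball (by simpa [mem_ball_iff_norm] using hvR)
  have hτd : τ ≤ ‖v‖ := min_le_left _ _
  set q := τ / D with hq
  have hq0 : 0 < q := by positivity
  have hq1 : q ≤ 1 := by rw [hq, div_le_one hD0]; linarith
  have hDq : D * q = τ := by rw [hq]; field_simp
  have hp : ‖L • (g • v)‖ = L * (g * ‖v‖) := by
    rw [norm_smul, norm_smul, Real.norm_of_nonneg hL0.le, Real.norm_of_nonneg hg0.le]
  have htouch : ∀ h : RN N, ‖h‖ < τ / 6 →
      u (x + v + h) ≤ u (x + v) + inner ℝ (L • (g • v)) h + L * c * ‖h‖ ^ 2 := by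
    intro h hh
    have hh' : ‖h‖ < R * e / 6 := hh.trans_le (by linarith [min_le_right ‖v‖ (R * e)])
    have k1 := hmax (v + h) (norm_add_lt_of_norm_lt hvR hh')
    have k2 := mul_le_mul_of_nonneg_left (barrier_add_le hγ' hv0 hvR hh') hL0.le
    rw [← he, ← hg, ← hc] at k2
    rw [inner_smul_left, add_assoc]
    simp only [conj_trivial]
    linarith
  have hδ : κ * q ∈ Ioo (0 : ℝ) 1 := by
    refine ⟨by positivity, ?_⟩
    have : κ ≤ 1 / 2 := min_le_left _ _
    nlinarith
  have hρ : Cj * (κ * q) ≤ τ / 6 := by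
    have h3 : κ ≤ D / (6 * Cj) := min_le_right _ _
    calc Cj * (κ * q) ≤ Cj * (D / (6 * Cj) * q) := by gcongr
      _ = D * q / 6 := by field_simp
      _ = τ / 6 := by rw [hDq]
  have key := hsub.norm_rpow_le hσ ⟨(div_pos hσ.1 hm0).le, ha1⟩ haσ hCj h1 h2 hj hu hyΩ
    (by positivity : 0 ≤ L * c) hδ hρ htouch
  rw [hp] at key
  -- The factor 5/6 in R leaves d(x + v) ≥ 6R/5 − |v| ≥ R/5 ≥ τ/5.
  have hℓ : D * q / 5 ≤ bdryDist Ω (x + v) := by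
    have h3 := bdryDist_le_add_norm_sub Ω x (x + v)
    rw [add_sub_cancel_left] at h3
    rw [hDq]
    linarith
  have hcP : L * c ≤ 80 / γ * (L * (g * ‖v‖) / (D * q)) := by
    rw [hDq]
    calc L * c ≤ L * (80 / γ * (g * ‖v‖ / τ)) := by gcongr
      _ = 80 / γ * (L * (g * ‖v‖) / τ) := by ring
  have hJ := hjump q ω (L * (g * ‖v‖)) (L * c) (bdryDist Ω (x + v)) hq0 hq1 hω0 (by positivity)
    hcP hℓ
  -- L was chosen so that Lγτ^(γ−1) equals the left-hand side exactly.
  have hP : M * (1 + ω) * q ^ (-(max σ θ / m)) ≤ L * (g * ‖v‖) := by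
    calc M * (1 + ω) * q ^ (-(max σ θ / m)) = L * (γ * τ ^ (γ - 1)) := by
          rw [← hDq, Real.mul_rpow hD0.le hq0.le,
            show γ - 1 = -(max σ θ / m) by rw [hγ]; ring, hL, Real.rpow_neg hD0.le]
          have := hγ'.1
          field_simp
      _ ≤ L * (g * ‖v‖) := by gcongr
  have hfin := hM q ω _ hq0 hq1 hω0 hP
  linarith

theorem barrier_le_rpow {N : ℕ} {γ R : ℝ} (hγ : γ ∈ Ioo (0 : ℝ) 1) {v : RN N} (hR : 0 < R)
    (hv : ‖v‖ ≤ 4 / 5 * R) : barrier γ R v ≤ 4 * ‖v‖ ^ γ := by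
  have hS0 : ‖v‖ / R ≤ 4 / 5 := by rw [div_le_iff₀ hR]; exact hv
  have hS0' : 0 ≤ ‖v‖ / R := by positivity
  have hS : ‖v‖ ^ 2 / R ^ 2 ≤ 16 / 25 := by
    rw [← div_pow]; nlinarith
  have h1 : (1 - ‖v‖ ^ 2 / R ^ 2)⁻¹ - 1 ≤ 3 * (‖v‖ / R) ^ 2 := by
    rw [div_pow, sub_le_iff_le_add, inv_le_iff_one_le_mul₀ (by linarith)]
    have : 0 ≤ ‖v‖ ^ 2 / R ^ 2 := by positivity
    nlinarith
  have h2 : (‖v‖ / R) ^ 2 ≤ (‖v‖ / R) ^ γ := by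
    rw [← Real.rpow_two]
    exact Real.rpow_le_rpow_of_exponent_ge_of_imp hS0' (by linarith) (by linarith [hγ.2])
      (fun _ h => absurd h two_ne_zero)
  have h3 : R ^ γ * (‖v‖ / R) ^ γ = ‖v‖ ^ γ := by
    rw [← Real.mul_rpow hR.le hS0']; congr 1; field_simp
  unfold barrier
  have h4 : R ^ γ * ((1 - ‖v‖ ^ 2 / R ^ 2)⁻¹ - 1) ≤ R ^ γ * (3 * (‖v‖ / R) ^ γ) := by
    gcongr
    linarith
  linarith

/-- The one-sided interior Hölder estimate. -/
theorem exists_interior_holder {N : ℕ} {Ω : Set (RN N)} (hΩo : IsOpen Ω)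
    (hΩb : Bornology.IsBounded Ω) {A b₀ σ m θ γ : ℝ} (hA : 0 < A) (hb₀ : 0 < b₀)
    (hσ : σ ∈ Ioo (0 : ℝ) 2) (hm1 : 1 < m) (hmσ : σ < m) (hθ : θ ∈ Ico (0 : ℝ) m)
    (hγ : γ = 1 - max σ θ / m) (hγ' : γ ∈ Ioo (0 : ℝ) 1) (K₁ K₂ : ℝ → ℝ) {Cj : ℝ} (hCj : 0 < Cj) :
    ∃ C : ℝ, 0 < C ∧ ∀ (ν : Measure (RN N)) (j : RN N → RN N → RN N),
      CondM1 σ K₁ ν → CondM2 σ K₂ ν → CondJ1 Cj j →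
      ∀ u : RN N → ℝ, (∃ M : ℝ, ∀ x, |u x| ≤ M) →
        IsViscositySubsolution σ m θ A b₀ ν j Ω u →
        ∀ x₀ ∈ Ω, ∀ r : ℝ, 0 < r → r ≤ bdryDist Ω x₀ / 4 →
          ∀ x ∈ Metric.ball x₀ r, ∀ y ∈ Metric.ball x₀ r,
            |u x - u y| ≤ C * (1 + osc (reachableSet Ω ν j) u) * ‖x - y‖ ^ γ := by
  obtain ⟨C, hC, hbar⟩ := exists_barrier_bound hΩo hΩb hA hb₀ hσ hm1 hmσ hθ hγ K₁ K₂ hCj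
  refine ⟨C * 4, by positivity, fun ν j h1 h2 hj u hu hsub x₀ hx₀ r hr hr4 => ?_⟩
  have hω0 : 0 ≤ osc (reachableSet Ω ν j) u := (abs_nonneg _).trans
    (abs_sub_le_osc hu (Or.inl hx₀ : x₀ ∈ reachableSet Ω ν j) (Or.inl hx₀))
  have key : ∀ x ∈ Metric.ball x₀ r, ∀ y ∈ Metric.ball x₀ r,
      u y - u x ≤ C * 4 * (1 + osc (reachableSet Ω ν j) u) * ‖x - y‖ ^ γ := by
    intro x hx y hy
    have hxΩ : x ∈ Ω := ball_bdryDist_subset hΩo hx₀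
      (Metric.ball_subset_ball (by linarith) hx)
    rw [mem_ball_iff_norm] at hx hy
    have hdx : 3 * r ≤ bdryDist Ω x := by
      have := bdryDist_le_add_norm_sub Ω x₀ x
      linarith
    have hxy : ‖y - x‖ < 2 * r := by
      calc ‖y - x‖ = ‖(y - x₀) - (x - x₀)‖ := by rw [sub_sub_sub_cancel_right]
        _ ≤ ‖y - x₀‖ + ‖x - x₀‖ := norm_sub_le _ _
        _ < 2 * r := by linarith
    -- Since |y − x| < 2r ≤ (2/3)d(x) = (4/5)R, the point y stays away from the blow-up sphere.
    have k1 := hbar ν j h1 h2 hj u hu hsub x hxΩ (y - x) (by linarith)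
    have k2 := barrier_le_rpow hγ' (v := y - x) (R := 5 / 6 * bdryDist Ω x) (by linarith)
      (by linarith)
    rw [add_sub_cancel] at k1
    rw [norm_sub_rev x y]
    have k3 : C * (1 + osc (reachableSet Ω ν j) u) * barrier γ (5 / 6 * bdryDist Ω x) (y - x) ≤
        C * (1 + osc (reachableSet Ω ν j) u) * (4 * ‖y - x‖ ^ γ) := by gcongr
    linarith
  intro x hx y hy
  rw [abs_le]
  have k1 := key x hx y hy
  have k2 := key y hy x hx
  rw [norm_sub_rev y x] at k2
  constructor <;> linarith

/-! ### The uniform interior cone condition -/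

theorem le_bdryDist {N : ℕ} {Ω : Set (RN N)} (hΩ : IsOpen Ω) (hf : (frontier Ω).Nonempty)
    {x : RN N} {r : ℝ} (h : Metric.ball x r ⊆ Ω) : r ≤ bdryDist Ω x := by
  refine (Metric.le_infDist hf).2 fun w hw => ?_
  by_contra! hcon
  rw [hΩ.frontier_eq] at hw
  exact hw.2 (h (Metric.mem_ball'.2 hcon))

theorem bdryDist_pos {N : ℕ} {Ω : Set (RN N)} (hΩ : IsOpen Ω) (hf : (frontier Ω).Nonempty)
    {x : RN N} (hx : x ∈ Ω) : 0 < bdryDist Ω x := by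
  obtain ⟨r, hr, h⟩ := Metric.isOpen_iff.1 hΩ x hx
  exact hr.trans_le (le_bdryDist hΩ hf h)

/-- `Ω` contains the truncated cones of height `ε` and aperture `c` with vertices near `S`, whose
axis depends only on the nearby point of `S`. -/
def HasConesAlong {N : ℕ} (Ω S : Set (RN N)) (ε c : ℝ) : Prop :=
  ∀ f ∈ S, ∃ e : RN N, ‖e‖ = 1 ∧ ∀ y ∈ Ω, ‖y - f‖ < ε → ∀ t ∈ Ioo (0 : ℝ) ε,
    Metric.ball (y + t • e) (c * t) ⊆ Ω

theorem HasConesAlong.mono {N : ℕ} {Ω S : Set (RN N)} {ε c ε' c' : ℝ}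
    (h : HasConesAlong Ω S ε c) (hε : ε' ≤ ε) (hc : c' ≤ c) : HasConesAlong Ω S ε' c' := by
  intro f hf
  obtain ⟨e, he, H⟩ := h f hf
  refine ⟨e, he, fun y hy hyf t ht => ?_⟩
  exact (Metric.ball_subset_ball (mul_le_mul_of_nonneg_right hc ht.1.le)).trans
    (H y hy (hyf.trans_le hε) t ⟨ht.1, ht.2.trans_le hε⟩)

/-- The graph is locally K-Lipschitz. A perturbation k of y + te moves the horizontal part by at
most 2|k| and the height by at most |k|, so the point stays above the graph while (2K + 1)|k| < t.
-/
theorem HasC11Boundary.exists_local_cones {N : ℕ} {Ω : Set (RN N)} (h : HasC11Boundary Ω)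
    {f : RN N} (hf : f ∈ frontier Ω) :
    ∃ r > 0, ∃ c ∈ Ioc (0 : ℝ) 1, HasConesAlong Ω (Metric.ball f r) r c := by
  obtain ⟨e, he, ψ, hψ, -, r, hr, hΩ⟩ := h f hf
  set π : RN N → RN N := fun y => y - (inner ℝ e y : ℝ) • e with hπ
  have hπc : Continuous π := by fun_prop
  obtain ⟨K, s, hs, hK⟩ := hψ.locallyLipschitz (π f)
  obtain ⟨r₁, hr₁, hr₁s⟩ := Metric.mem_nhds_iff.1 (hπc.continuousAt.preimage_mem_nhds hs)
  set r₂ := min r r₁ with hr₂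
  have hr₂0 : 0 < r₂ := lt_min hr hr₁
  have hK0 : (0 : ℝ) ≤ K := K.2
  refine ⟨r₂ / 4, by positivity, 1 / (2 * K + 1), ⟨by positivity, ?_⟩, ?_⟩
  · rw [div_le_one (by positivity)]; linarith
  intro f' hf'
  refine ⟨e, he, fun y hy hyf t ht w hw => ?_⟩
  set c : ℝ := 1 / (2 * K + 1) with hc
  have hcK : c * (2 * K + 1) = 1 := by rw [hc]; field_simp
  have hc1 : c ≤ 1 := by rw [hc, div_le_one (by positivity)]; linarith
  rw [mem_ball_iff_norm] at hw hf'
  have hyball : y ∈ Metric.ball f r₂ := by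
    rw [mem_ball_iff_norm]
    have := norm_add_le (y - f') (f' - f)
    rw [sub_add_sub_cancel] at this
    linarith
  have hte : ‖t • e‖ = t := by rw [norm_smul, he, mul_one, Real.norm_of_nonneg ht.1.le]
  have hwball : w ∈ Metric.ball f r₂ := by
    rw [mem_ball_iff_norm]
    have h1 : w - f = (w - (y + t • e)) + t • e + (y - f') + (f' - f) := by abel
    have h2 : ‖w - f‖ ≤ ‖w - (y + t • e)‖ + ‖t • e‖ + ‖y - f'‖ + ‖f' - f‖ := by
      rw [h1]; exact norm_add₄_le
    have h3 : c * t ≤ t := by nlinarith [ht.1]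
    have := ht.2
    rw [hte] at h2
    linarith
  have hyΩ := (hΩ y (Metric.ball_subset_ball (min_le_left _ _) hyball)).1 hy
  rw [hΩ w (Metric.ball_subset_ball (min_le_left _ _) hwball)]
  have hlip := hK.dist_le_mul (π w) (hr₁s (Metric.ball_subset_ball (min_le_right _ _) hwball))
    (π y) (hr₁s (Metric.ball_subset_ball (min_le_right _ _) hyball))
  set k := w - (y + t • e) with hk
  have hwk : w = y + t • e + k := by rw [hk]; abel
  have hee : inner ℝ e e = (1 : ℝ) := by rw [real_inner_self_eq_norm_sq, he]; norm_num
  have hin : (inner ℝ e w : ℝ) = inner ℝ e y + t + inner ℝ e k := by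
    rw [hwk, inner_add_right, inner_add_right, inner_smul_right, hee, mul_one]
  have hek : |(inner ℝ e k : ℝ)| ≤ ‖k‖ := by
    have := abs_real_inner_le_norm e k
    rwa [he, one_mul] at this
  have hπwy : ‖π w - π y‖ ≤ 2 * ‖k‖ := by
    have : π w - π y = k - (inner ℝ e k : ℝ) • e := by
      simp only [hπ, hin]
      rw [hwk]
      module
    rw [this]
    refine (norm_sub_le _ _).trans ?_
    rw [norm_smul, he, mul_one, Real.norm_eq_abs]
    linarith
  rw [dist_eq_norm, dist_eq_norm, Real.norm_eq_abs] at hlip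
  have h1 := (abs_le.1 (hlip.trans (mul_le_mul_of_nonneg_left hπwy hK0))).2
  have h2 := (abs_le.1 hek).1
  have h3 : (2 * K + 1) * ‖k‖ < t := by
    calc (2 * K + 1) * ‖k‖ < (2 * K + 1) * (c * t) := by gcongr
      _ = c * (2 * K + 1) * t := by ring
      _ = t := by rw [hcK, one_mul]
  have h4 : ψ (π y) < inner ℝ e y := hyΩ
  change ψ (π w) < inner ℝ e w
  rw [hin]
  linarith

theorem HasC11Boundary.exists_cones {N : ℕ} {Ω : Set (RN N)} (hΩb : Bornology.IsBounded Ω)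
    (h : HasC11Boundary Ω) :
    ∃ ε > 0, ∃ c ∈ Ioc (0 : ℝ) 1, HasConesAlong Ω (frontier Ω) ε c := by
  have hcomp : IsCompact (frontier Ω) := Metric.isCompact_of_isClosed_isBounded isClosed_frontier
    (hΩb.closure.subset frontier_subset_closure)
  refine hcomp.induction_on (p := fun S => ∃ ε > 0, ∃ c ∈ Ioc (0 : ℝ) 1, HasConesAlong Ω S ε c)
    ?_ ?_ ?_ ?_
  · exact ⟨1, one_pos, 1, ⟨one_pos, le_rfl⟩, fun f hf => hf.elim⟩
  · rintro S T hST ⟨ε, hε, c, hc, H⟩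
    exact ⟨ε, hε, c, hc, fun f hf => H f (hST hf)⟩
  · rintro S T ⟨ε, hε, c, hc, H⟩ ⟨ε', hε', c', hc', H'⟩
    refine ⟨min ε ε', lt_min hε hε', min c c',
      ⟨lt_min hc.1 hc'.1, (min_le_left _ _).trans hc.2⟩, ?_⟩
    rintro f (hf | hf)
    · exact H.mono (min_le_left _ _) (min_le_left _ _) f hf
    · exact H'.mono (min_le_right _ _) (min_le_right _ _) f hf
  · intro f hf
    obtain ⟨r, hr, c, hc, H⟩ := h.exists_local_cones hf
    exact ⟨Metric.ball f r, mem_nhdsWithin_of_mem_nhds (Metric.ball_mem_nhds f hr), r, hr, c, hc, H⟩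

/-! ### From local to global Hölder estimates -/

/-- Telescoping over x + qⁿte with q = 1 − c/8: each step has length (c/8)τ, below a quarter of the
distance cτ guaranteed by the cone, and the increments form a geometric series of ratio q^γ. -/
theorem abs_sub_le_along_ray {N : ℕ} {Ω : Set (RN N)} (hΩ : IsOpen Ω)
    (hfr : (frontier Ω).Nonempty) {γ L c t : ℝ} (hγ : 0 < γ) (hL : 0 ≤ L)
    (hc : c ∈ Ioc (0 : ℝ) 1) (ht : 0 < t) {u : RN N → ℝ}
    (hloc : ∀ x ∈ Ω, ∀ y, ‖y - x‖ < bdryDist Ω x / 4 → |u x - u y| ≤ L * ‖x - y‖ ^ γ)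
    {x e : RN N} (hx : x ∈ Ω) (he : ‖e‖ = 1)
    (hcone : ∀ τ ∈ Ioc (0 : ℝ) t, Metric.ball (x + τ • e) (c * τ) ⊆ Ω) :
    |u (x + t • e) - u x| ≤ L * (1 / (1 - (1 - c / 8) ^ γ)) * t ^ γ := by
  obtain ⟨hc0, hc1⟩ := hc
  set q := 1 - c / 8 with hq
  have hq0 : 0 < q := by linarith
  have hq1 : q < 1 := by linarith
  set Q := q ^ γ with hQ
  have hQ0 : 0 < Q := by positivity
  have hQ1 : Q < 1 := Real.rpow_lt_one hq0.le hq1 hγ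
  set M := 1 / (1 - Q) with hM
  have hMQ : M * (1 - Q) = 1 := by
    rw [hM, one_div_mul_cancel]; linarith
  have hM1 : 1 ≤ M := by rw [hM, le_div_iff₀ (by linarith)]; linarith
  have hpow : ∀ n : ℕ, (q ^ n * t) ^ γ = Q ^ n * t ^ γ := fun n => by
    rw [Real.mul_rpow (by positivity) ht.le, hQ, ← Real.rpow_natCast, ← Real.rpow_mul hq0.le,
      mul_comm (n : ℝ), Real.rpow_mul hq0.le, Real.rpow_natCast]
  have htγ : 0 < t ^ γ := by positivity
  have hmem : ∀ n : ℕ, q ^ n * t ∈ Ioc (0 : ℝ) t := fun n => by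
    refine ⟨by positivity, ?_⟩
    have := pow_le_one₀ (n := n) hq0.le hq1.le
    nlinarith
  have hstep : ∀ n : ℕ, |u (x + (q ^ n * t) • e) - u (x + (q ^ (n + 1) * t) • e)| ≤
      L * (Q ^ n * t ^ γ) := by
    intro n
    obtain ⟨hτ0, hτt⟩ := hmem n
    set τ := q ^ n * t with hτ
    have hb := hcone τ ⟨hτ0, hτt⟩
    have hmemΩ : x + τ • e ∈ Ω := hb (Metric.mem_ball_self (by positivity))
    have hbd := le_bdryDist hΩ hfr hb
    have hdist : ‖x + (q ^ (n + 1) * t) • e - (x + τ • e)‖ = c / 8 * τ := by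
      have : x + (q ^ (n + 1) * t) • e - (x + τ • e) = (-(c / 8 * τ)) • e := by
        rw [add_sub_add_left_eq_sub, ← sub_smul]
        congr 1
        rw [hτ, hq]; ring
      rw [this, norm_smul, he, mul_one, norm_neg, Real.norm_of_nonneg (by positivity)]
    have hcτ : 0 < c * τ := by positivity
    refine (hloc _ hmemΩ _ (by rw [hdist]; linarith)).trans ?_
    rw [norm_sub_rev, hdist, ← hpow n, ← hτ]
    gcongr
    nlinarith
  have hsum : ∀ n : ℕ, |u (x + t • e) - u (x + (q ^ n * t) • e)| ≤
      L * (M * (1 - Q ^ n) * t ^ γ) := by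
    intro n
    induction n with
    | zero => simp
    | succ n ih =>
      refine (abs_sub_le _ (u (x + (q ^ n * t) • e)) _).trans
        ((add_le_add ih (hstep n)).trans (le_of_eq ?_))
      linear_combination (-(L * Q ^ n * t ^ γ)) * hMQ
  have hd := bdryDist_pos hΩ hfr hx
  -- As x is interior, finitely many steps reach its own local ball, so no boundary regularity of u
  -- is required.
  obtain ⟨n, hn⟩ := exists_pow_lt_of_lt_one (show 0 < bdryDist Ω x / 4 / t by positivity) hq1
  rw [lt_div_iff₀ ht] at hn
  have hnorm : ‖x + (q ^ n * t) • e - x‖ = q ^ n * t := by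
    rw [add_sub_cancel_left, norm_smul, he, mul_one, Real.norm_of_nonneg (hmem n).1.le]
  have hlast := hloc x hx (x + (q ^ n * t) • e) (by rw [hnorm]; exact hn)
  rw [norm_sub_rev, hnorm, hpow] at hlast
  rw [abs_sub_comm] at hlast
  refine (abs_sub_le _ (u (x + (q ^ n * t) • e)) _).trans ((add_le_add (hsum n) hlast).trans ?_)
  have hQn : 0 < Q ^ n := by positivity
  rw [← mul_add, ← add_mul, mul_assoc]
  gcongr L * (?_ * _)
  nlinarith

theorem HasConesAlong.exists_global_holder {N : ℕ} {Ω : Set (RN N)} (hΩ : IsOpen Ω)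
    (hfr : (frontier Ω).Nonempty) {γ ε c : ℝ} (hγ : 0 < γ) (hε : 0 < ε)
    (hc : c ∈ Ioc (0 : ℝ) 1) (hcones : HasConesAlong Ω (frontier Ω) ε c) :
    ∃ C : ℝ, 0 < C ∧ ∀ (u : RN N → ℝ) (L ω : ℝ), 0 ≤ L → 0 ≤ ω →
      (∀ x ∈ Ω, ∀ y, ‖y - x‖ < bdryDist Ω x / 4 → |u x - u y| ≤ L * ‖x - y‖ ^ γ) →
      (∀ x ∈ Ω, ∀ y ∈ Ω, |u x - u y| ≤ ω) →
      ∀ x ∈ Ω, ∀ y ∈ Ω, |u x - u y| ≤ C * (L + ω) * ‖x - y‖ ^ γ := by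
  have hc0 := hc.1
  have hc1 := hc.2
  set M := 1 / (1 - (1 - c / 8) ^ γ) with hM
  have hM0 : 0 < M := by
    have : (1 - c / 8) ^ γ < 1 := Real.rpow_lt_one (by linarith) (by linarith) hγ
    rw [hM]
    exact one_div_pos.2 (by linarith)
  set η := c * ε / 16 with hη
  have hη0 : 0 < η := by positivity
  set C₁ := 2 * (M * (8 / c) ^ γ) + 1 with hC₁
  have hC₁1 : 1 ≤ C₁ := by
    have : 0 ≤ 2 * (M * (8 / c) ^ γ) := by positivity
    linarith
  have hη' : 0 ≤ (η ^ γ)⁻¹ := by positivity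
  refine ⟨C₁ + (η ^ γ)⁻¹, by positivity, fun u L ω hL hω hloc hosc x hx y hy => ?_⟩
  rcases eq_or_ne x y with rfl | hne
  · simp only [sub_self, abs_zero]; positivity
  set ℓ := ‖x - y‖ with hℓ
  have hℓ0 : 0 < ℓ := norm_pos_iff.2 (sub_ne_zero.2 hne)
  have hℓγ : 0 < ℓ ^ γ := by positivity
  have hsplit : (C₁ + (η ^ γ)⁻¹) * (L + ω) * ℓ ^ γ = C₁ * L * ℓ ^ γ + ω * ((η ^ γ)⁻¹ * ℓ ^ γ) +
      (C₁ * ω + (η ^ γ)⁻¹ * L) * ℓ ^ γ := by ring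
  have hrest : 0 ≤ (C₁ * ω + (η ^ γ)⁻¹ * L) * ℓ ^ γ := by positivity
  have hωterm : 0 ≤ ω * ((η ^ γ)⁻¹ * ℓ ^ γ) := by positivity
  rw [hsplit]
  rcases le_or_gt η ℓ with hbig | hsmall
  · have h1 : 1 ≤ (η ^ γ)⁻¹ * ℓ ^ γ := by
      rw [← div_eq_inv_mul, le_div_iff₀ (by positivity), one_mul]
      gcongr
    have h2 := hosc x hx y hy
    have h3 : 0 ≤ C₁ * L * ℓ ^ γ := by positivity
    nlinarith
  suffices h : |u x - u y| ≤ C₁ * L * ℓ ^ γ by linarith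
  rcases lt_or_ge (4 * ℓ) (bdryDist Ω x) with hfar | hnear
  · refine (hloc x hx y (by rw [norm_sub_rev]; linarith)).trans ?_
    rw [← hℓ]
    gcongr
    nlinarith
  -- Both points are now close to one boundary point f and share its cone axis.
  obtain ⟨f, hf, hxf⟩ := (Metric.infDist_lt_iff (x := x) (r := ε / 2) hfr).1 (by
    change bdryDist Ω x < ε / 2
    have : η ≤ ε / 16 := by rw [hη]; nlinarith
    linarith)
  rw [dist_eq_norm] at hxf
  obtain ⟨e, he, H⟩ := hcones f hf
  have hℓε : ℓ < ε / 16 := by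
    have : η ≤ ε / 16 := by rw [hη]; nlinarith
    linarith
  have hyf : ‖y - f‖ < ε := by
    have := norm_add_le (y - x) (x - f)
    rw [sub_add_sub_cancel, norm_sub_rev y x] at this
    linarith
  -- At this height the cone gives distance at least ct = 8ℓ to the boundary, so the raised points,
  -- still ℓ apart, lie within the local range 2ℓ.
  set t := 8 / c * ℓ with ht
  have ht0 : 0 < t := by positivity
  have hct : c * t = 8 * ℓ := by rw [ht]; field_simp
  have htε : t < ε := by
    have : c * t < c * ε := by rw [hct]; linarith
    exact lt_of_mul_lt_mul_left this hc0.le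
  have hray : ∀ z ∈ Ω, ‖z - f‖ < ε → |u (z + t • e) - u z| ≤ L * M * t ^ γ := fun z hz hzf =>
    abs_sub_le_along_ray hΩ hfr hγ hL hc ht0 hloc hz he
      fun τ hτ => H z hz hzf τ ⟨hτ.1, hτ.2.trans_lt htε⟩
  have hbx := H x hx (by linarith) t ⟨ht0, htε⟩
  have htop : |u (x + t • e) - u (y + t • e)| ≤ L * ℓ ^ γ := by
    have hn : ‖y + t • e - (x + t • e)‖ = ℓ := by
      rw [add_sub_add_right_eq_sub, norm_sub_rev]
    have hbd := le_bdryDist hΩ hfr hbx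
    have := hloc (x + t • e) (hbx (Metric.mem_ball_self (by positivity))) (y + t • e)
      (by rw [hn]; linarith)
    rwa [norm_sub_rev, hn] at this
  have h1 := abs_le.1 (hray x hx (by linarith))
  have h2 := abs_le.1 (hray y hy hyf)
  have h3 := abs_le.1 htop
  have h4 : L * M * t ^ γ = L * (M * (8 / c) ^ γ) * ℓ ^ γ := by
    rw [ht, Real.mul_rpow (by positivity) hℓ0.le]; ring
  have h5 : C₁ * L * ℓ ^ γ = 2 * (L * M * t ^ γ) + L * ℓ ^ γ := by rw [h4, hC₁]; ring
  rw [h5, abs_le]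
  constructor <;> linarith

/-- McShane's extension for Hölder functions. -/
theorem exists_holder_extension {N : ℕ} {Ω : Set (RN N)} (hne : Ω.Nonempty) {u : RN N → ℝ}
    (hu : ∃ M : ℝ, ∀ x, |u x| ≤ M) {L γ : ℝ} (hL : 0 ≤ L) (hγ : γ ∈ Ioo (0 : ℝ) 1)
    (h : ∀ x ∈ Ω, ∀ y ∈ Ω, |u x - u y| ≤ L * ‖x - y‖ ^ γ) :
    ∃ v : RN N → ℝ, EqOn v u Ω ∧ ∀ x y, |v x - v y| ≤ L * ‖x - y‖ ^ γ := by
  obtain ⟨M, hM⟩ := hu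
  have : Nonempty Ω := hne.to_subtype
  set v : RN N → ℝ := fun x => ⨅ y : Ω, (u y + L * ‖x - y‖ ^ γ) with hv
  have hbdd : ∀ x : RN N, BddBelow (range fun y : Ω => u y + L * ‖x - y‖ ^ γ) := by
    refine fun x => ⟨-M, ?_⟩
    rintro _ ⟨y, rfl⟩
    have h1 := (abs_le.1 (hM y)).1
    have h2 : 0 ≤ L * ‖x - y‖ ^ γ := by positivity
    change -M ≤ u y + L * ‖x - y‖ ^ γ
    linarith
  have hle : ∀ x y, v x ≤ v y + L * ‖x - y‖ ^ γ := by
    intro x y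
    rw [← sub_le_iff_le_add]
    refine le_ciInf fun w => ?_
    rw [sub_le_iff_le_add]
    refine (ciInf_le (hbdd x) w).trans ?_
    -- Subadditivity of t ↦ t^γ for γ ≤ 1 makes |x − y|^γ satisfy the triangle inequality.
    have h1 : ‖x - w‖ ^ γ ≤ ‖y - w‖ ^ γ + ‖x - y‖ ^ γ := by
      calc ‖x - w‖ ^ γ ≤ (‖y - w‖ + ‖x - y‖) ^ γ := by
            have := norm_add_le (y - (w : RN N)) (x - y)
            rw [sub_add_sub_cancel'] at this
            have := hγ.1
            gcongr
        _ ≤ _ := Real.rpow_add_le_add_rpow (norm_nonneg _) (norm_nonneg _) hγ.1.le hγ.2.le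
    nlinarith
  refine ⟨v, fun x hx => le_antisymm ?_ ?_, fun x y => ?_⟩
  · refine (ciInf_le (hbdd x) ⟨x, hx⟩).trans (le_of_eq ?_)
    simp [Real.zero_rpow hγ.1.ne']
  · refine le_ciInf fun w => ?_
    have := (abs_le.1 (h x hx w w.2)).2
    linarith
  · have h1 := hle x y
    have h2 := hle y x
    rw [norm_sub_rev y x] at h2
    rw [abs_le]
    constructor <;> linarith

/-! ### Assembly of the main theorem -/

theorem gammaZero_eq {σ m θ : ℝ} (hm : 0 < m) : gammaZero σ m θ = 1 - max σ θ / m := by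
  have h : ∀ k : ℝ, (m - k) / m = 1 - k / m := fun k => by field_simp
  rw [gammaZero, h, h, min_sub_sub_left, max_div_div_right hm.le]

theorem frontier_nonempty_of_isBounded {N : ℕ} (hN : 1 ≤ N) {Ω : Set (RN N)} (hne : Ω.Nonempty)
    (hΩb : Bornology.IsBounded Ω) : (frontier Ω).Nonempty := by
  have : Nonempty (Fin N) := ⟨⟨0, hN⟩⟩
  refine nonempty_frontier_iff.2 ⟨hne, fun h => ?_⟩
  rw [h] at hΩb
  exact NormedSpace.unbounded_univ ℝ (RN N) hΩb

theorem mainTheorem6 (N : ℕ) (hN : 1 ≤ N)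
    (Ω : Set (RN N)) (hΩo : IsOpen Ω) (hΩc : IsConnected Ω) (hΩb : Bornology.IsBounded Ω)
    (A b₀ σ m θ : ℝ) (hA : 0 < A) (hb₀ : 0 < b₀) (hσ : σ ∈ Set.Ioo (0 : ℝ) 2)
    (hm : max 1 σ < m) (hθ : θ ∈ Set.Ico (0 : ℝ) m)
    (K₁ K₂ : ℝ → ℝ) (Cj : ℝ) (hCj : 0 < Cj) :
    ∃ L : ℝ → ℝ, Monotone L ∧
      ∀ (ν : MeasureTheory.Measure (RN N)) (j : RN N → RN N → RN N),
        CondM1 σ K₁ ν → CondM2 σ K₂ ν → CondJ1 Cj j →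
        ∀ u : RN N → ℝ, Measurable u → (∃ M : ℝ, ∀ x, |u x| ≤ M) →
          IsViscositySubsolution σ m θ A b₀ ν j Ω u →
          (∀ x₀ ∈ Ω, ∀ r : ℝ, 0 < r → r ≤ bdryDist Ω x₀ / 4 →
            ∀ x ∈ Metric.ball x₀ r, ∀ y ∈ Metric.ball x₀ r,
              |u x - u y| ≤ L (osc (reachableSet Ω ν j) u) * ‖x - y‖ ^ gammaZero σ m θ) ∧
          (HasC11Boundary Ω →
            ∃ v : RN N → ℝ, Set.EqOn v u Ω ∧
              ∀ x ∈ closure Ω, ∀ y ∈ closure Ω,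
                |v x - v y| ≤ L (osc (reachableSet Ω ν j) u) * ‖x - y‖ ^ gammaZero σ m θ) := by
  obtain ⟨hm1, hmσ⟩ := max_lt_iff.1 hm
  have hm0 : 0 < m := by linarith
  have hγ := gammaZero_eq (σ := σ) (θ := θ) hm0
  set γ := gammaZero σ m θ
  have hγ' : γ ∈ Ioo (0 : ℝ) 1 := by
    have hs0 : 0 < max σ θ / m := div_pos (hσ.1.trans_le (le_max_left _ _)) hm0
    have hs1 : max σ θ / m < 1 := (div_lt_one hm0).2 (max_lt hmσ hθ.2)
    rw [hγ]
    constructor <;> linarith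
  have hfr := frontier_nonempty_of_isBounded hN hΩc.nonempty hΩb
  obtain ⟨C, hC, hint⟩ := exists_interior_holder hΩo hΩb hA hb₀ hσ hm1 hmσ hθ hγ hγ' K₁ K₂ hCj
  -- The constant must be fixed before boundary regularity is assumed; 1 is a dummy value for a
  -- domain without it.
  obtain ⟨C', hC', hglob⟩ : ∃ C' : ℝ, 0 < C' ∧ (HasC11Boundary Ω →
      ∀ (u : RN N → ℝ) (L ω : ℝ), 0 ≤ L → 0 ≤ ω →
        (∀ x ∈ Ω, ∀ y, ‖y - x‖ < bdryDist Ω x / 4 → |u x - u y| ≤ L * ‖x - y‖ ^ γ) →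
        (∀ x ∈ Ω, ∀ y ∈ Ω, |u x - u y| ≤ ω) →
        ∀ x ∈ Ω, ∀ y ∈ Ω, |u x - u y| ≤ C' * (L + ω) * ‖x - y‖ ^ γ) := by
    by_cases h : HasC11Boundary Ω
    · obtain ⟨ε, hε, c, hc, hcones⟩ := h.exists_cones hΩb
      obtain ⟨C', hC', H⟩ := hcones.exists_global_holder hΩo hfr hγ'.1 hε hc
      exact ⟨C', hC', fun _ => H⟩
    · exact ⟨1, one_pos, fun h' => absurd h' h⟩
  refine ⟨fun ω => C * (1 + max ω 0) + C' * (C * (1 + max ω 0) + max ω 0), ?_, ?_⟩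
  · intro ω ω' hω
    dsimp only
    gcongr
  intro ν j h1 h2 hj u _ hu hsub
  have hosc : ∀ x ∈ Ω, ∀ y ∈ Ω, |u x - u y| ≤ osc (reachableSet Ω ν j) u :=
    fun x hx y hy => abs_sub_le_osc hu (Or.inl hx) (Or.inl hy)
  obtain ⟨z, hz⟩ := hΩc.nonempty
  have hω0 : 0 ≤ osc (reachableSet Ω ν j) u := (abs_nonneg _).trans (hosc z hz z hz)
  have hintu := hint ν j h1 h2 hj u hu hsub
  dsimp only
  rw [max_eq_left hω0]
  set ω := osc (reachableSet Ω ν j) u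
  have hL0 : 0 ≤ C * (1 + ω) := by positivity
  have hG0 : 0 ≤ C' * (C * (1 + ω) + ω) := by positivity
  refine ⟨fun x₀ hx₀ r hr hr4 x hx y hy => (hintu x₀ hx₀ r hr hr4 x hx y hy).trans ?_, fun hΩ => ?_⟩
  · gcongr
    linarith
  · have hloc : ∀ x ∈ Ω, ∀ y, ‖y - x‖ < bdryDist Ω x / 4 →
        |u x - u y| ≤ C * (1 + ω) * ‖x - y‖ ^ γ := fun x hx y hy => by
      have hpos := bdryDist_pos hΩo hfr hx
      exact hintu x hx _ (by positivity) le_rfl x (Metric.mem_ball_self (by positivity)) y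
        (mem_ball_iff_norm.2 hy)
    obtain ⟨v, hv, hvL⟩ := exists_holder_extension ⟨z, hz⟩ hu hG0 hγ'
      (hglob hΩ u _ _ hL0 hω0 hloc hosc)
    refine ⟨v, hv, fun x _ y _ => (hvL x y).trans ?_⟩
    gcongr
    linarith
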